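/- **Theorem (Efficient unitary $t$-design).** For every constant $K_0$ there is a constant $K>0$, depending only on $K_0$, such that the following holds for all integers $n,t\ge 0$, with $d=2^n$ and $[d]$ identified with $\{0,1\}^n$. Let $\mathcal F$ be a probability distribution on functions $f:[d]\to\{0,1\}$ (for instance, the uniform distribution on a finite function family) that is $2t$-wise independent: for all distinct $x_1,\dots,x_{2t}\in[d]$ and all $y_1,\dots,y_{2t}\in\{0,1\}$, $$\Pr_{f\sim\mathcal F}[f(x_1)=y_1\wedge\dots\wedge f(x_{2t})=y_{2t}]=2^{-2t}.$$ Let $\mathcal D$ be a probability distribution on permutations of $[d]$ that is $\delta$-approximate $t$-wise independent: for all distinct $x_1,\dots,x_t\in[d]$ and all distinct $y_1,\dots,y_t\in[d]$, $$\Bigl|\Pr_{\pi\sim\mathcal D}[\pi(x_1)=y_1\wedge\dots\wedge\pi(x_t)=y_t]-\frac1{d(d-1)\cdots(d-t+1)}\Bigr|\le\delta,\qquad\text{where }\ \delta\le K_0\,\frac{t}{d^{4t+1/2}}.$$ Let $\nu$ be the law of the random unitary $U=P_\pi F_f C\in\mathrm U(d)$, where $\pi\sim\mathcal D$, $f\sim\mathcal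 F$ and a uniformly random element $C$ of the $n$-qubit Clifford group (the normalizer of the $n$-qubit Pauli group in $\mathrm U(d)$, with its Haar probability measure; global phases are immaterial) are independent, $P_\pi|x\rangle=|\pi(x)\rangle$ and $F_f|x\rangle=(-1)^{f(x)}|x\rangle$. Then $\nu$ is a diamond $\epsilon$-approximate $t$-design with $\epsilon=K\,t/\sqrt d$, that is, $$\bigl\|\mathcal M^{(t)}_\nu-\mathcal M^{(t)}_{\mathrm{Haar}}\bigr\|_\Diamond\le K\,\frac{t}{\sqrt d},$$ where $\mathcal M^{(t)}_\mu(A)=\mathbb E_{R\sim\mu}\,R^{\otimes t}A\,(R^{\otimes t})^\dagger$ for $A\in\mathrm L(\mathcal H)$, $\mathcal H=(\mathbb C^d)^{\otimes t}$, Haar denotes the Haar probability measure on $\mathrm U(d)$, and $\|\mathcal M-\mathcal N\|_\Diamond=\max_{\psi}\|(\mathcal M\otimes\mathrm{id}_{\mathcal H})(|\psi\rangle\langle\psi|)-(\mathcal N\otimes\mathrm{id}_{\mathcal H})(|\psi\rangle\langle\psi|)\|_1$, the maximum being over unit vectors $\psi\in\mathcal H\otimes\mathcal H$ and $\|\cdot\|_1$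 being the trace norm. -/

import Mathlib

open MeasureTheory
open scoped Matrix ENNReal

noncomputable section

/-! ### Probability: Haar measure and `t`-wise independence -/

/-- The Haar probability measure of a compact topological group. -/
def haarProb (G : Type*) [Group G] [TopologicalSpace G] [IsTopologicalGroup G] [CompactSpace G]
    [MeasurableSpace G] [BorelSpace G] : Measure G :=
  Measure.haarMeasure ⊤

/-- A distribution over functions `α → β` is `t`-wise independent if its values at any `t` distinct
points are independent and uniform: `Pr[f(x₁) = y₁ ∧ … ∧ f(x_t) = y_t] = |β|^{-t}`. -/
def IsTWiseIndependent {α β : Type*} [Fintype β] (t : ℕ) (F : PMF (α → β)) : Prop :=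
  ∀ (x : Fin t → α) (y : Fin t → β), Function.Injective x →
    (F.toOuterMeasure {f | ∀ i, f (x i) = y i}).toReal = ((Fintype.card β : ℝ) ^ t)⁻¹

/-- A distribution over permutations of `α`, `N = |α|`, is `δ`-approximate `t`-wise independent if
for all distinct `x₁, …, x_t` and all distinct `y₁, …, y_t` the probability of
`π(x₁) = y₁ ∧ … ∧ π(x_t) = y_t` is within `δ` of `1 / (N (N-1) ⋯ (N-t+1))`. -/
def IsApproxTWiseIndependentPerm {α : Type*} [Fintype α] (t : ℕ) (δ : ℝ)
    (D : PMF (Equiv.Perm α)) : Prop :=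
  ∀ x y : Fin t → α, Function.Injective x → Function.Injective y →
    |(D.toOuterMeasure {π | ∀ i, π (x i) = y i}).toReal
      - (((Fintype.card α).descFactorial t : ℕ) : ℝ)⁻¹| ≤ δ

/-! ### The unitary group as a compact group with its Borel sets -/

section Unitary

variable {ι : Type*} [Fintype ι] [DecidableEq ι]

instance instCompactSpaceUnitaryGroup : CompactSpace (Matrix.unitaryGroup ι ℂ) := by
  have hK : IsCompact (Set.univ.pi fun _ : ι => Set.univ.pi fun _ : ι =>
      Metric.closedBall (0 : ℂ) 1) :=
    isCompact_univ_pi fun _ => isCompact_univ_pi fun _ => isCompact_closedBall _ _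
  have hc : IsClosed ((Matrix.unitaryGroup ι ℂ : Set (Matrix ι ι ℂ))) := isClosed_unitary
  refine isCompact_iff_compactSpace.mp (IsCompact.of_isClosed_subset (X := Matrix ι ι ℂ) hK hc ?_)
  intro U hU i _ j _
  simpa using entry_norm_bound_of_unitary hU i j

instance instMeasurableSpaceUnitaryGroup : MeasurableSpace (Matrix.unitaryGroup ι ℂ) :=
  borel _

instance instBorelSpaceUnitaryGroup : BorelSpace (Matrix.unitaryGroup ι ℂ) :=
  ⟨rfl⟩

/-- The permutation operator `P_π : |x⟩ ↦ |π(x)⟩`. -/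
def permOp (π : Equiv.Perm ι) : Matrix.unitaryGroup ι ℂ :=
  ⟨Matrix.of fun y x => if y = π x then 1 else 0, by
    rw [Matrix.mem_unitaryGroup_iff']
    ext x y
    simp [Matrix.mul_apply, Matrix.star_apply, Matrix.one_apply, eq_comm]⟩

/-- The binary phase operator `F_f : |x⟩ ↦ (-1)^{f(x)} |x⟩`. -/
def phaseOp (f : ι → ZMod 2) : Matrix.unitaryGroup ι ℂ :=
  ⟨Matrix.diagonal fun x => (-1) ^ (f x).val, by
    rw [Matrix.mem_unitaryGroup_iff', Matrix.star_eq_conjTranspose, Matrix.diagonal_conjTranspose,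
      Matrix.diagonal_mul_diagonal, ← Matrix.diagonal_one]
    congr 1
    funext x
    simp [← mul_pow]⟩

end Unitary

/-! ### The `n`-qubit Pauli and Clifford groups -/

/-- Bit strings of length `n`; they index the computational basis of `n` qubits, of dimension
`d = 2 ^ n`. -/
abbrev Bits (n : ℕ) : Type := Fin n → ZMod 2

/-- The matrix `X^a Z^b = ⨂ᵢ X^{aᵢ} Z^{bᵢ}`, that is `|x⟩ ↦ (-1)^{b·x} |x + a⟩`. -/
def pauliMatrix {n : ℕ} (a b : Bits n) : Matrix (Bits n) (Bits n) ℂ :=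
  Matrix.of fun y x => if y = x + a then (-1) ^ (b ⬝ᵥ x).val else 0

theorem neg_one_pow_val_add (u v : ZMod 2) :
    (-1 : ℂ) ^ (u + v).val = (-1) ^ u.val * (-1) ^ v.val := by
  have h : ∀ u v : ZMod 2, (u + v).val % 2 = (u.val + v.val) % 2 := by decide
  rw [← pow_add, neg_one_pow_eq_pow_mod_two, h, ← neg_one_pow_eq_pow_mod_two]

theorem bits_add_self {n : ℕ} (a : Bits n) : a + a = 0 :=
  funext fun i => CharTwo.add_self_eq_zero (a i)

theorem pauliMatrix_mul {n : ℕ} (a b c e : Bits n) :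
    pauliMatrix a b * pauliMatrix c e =
      ((-1 : ℂ) ^ (b ⬝ᵥ c).val) • pauliMatrix (a + c) (b + e) := by
  ext y x
  simp only [pauliMatrix, Matrix.mul_apply, Matrix.of_apply, Matrix.smul_apply, smul_eq_mul]
  rw [Finset.sum_eq_single (x + c) (fun z _ hz => by rw [if_neg hz, mul_zero]) (by simp)]
  rw [if_pos rfl, add_right_comm, ← add_assoc]
  by_cases h : y = x + a + c
  · simp only [h, if_true, dotProduct_add, add_dotProduct, neg_one_pow_val_add]
    ring
  · simp [h]

theorem pauliMatrix_zero {n : ℕ} : pauliMatrix (0 : Bits n) 0 = 1 := by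
  ext y x
  simp [pauliMatrix, Matrix.one_apply]

/-- The `n`-qubit Pauli group: the unitaries `i^k X^a Z^b`, equivalently all `n`-fold tensor
products of `I, X, Y, Z` with phases `±1, ±i`. -/
def pauliGroup (n : ℕ) : Subgroup (Matrix.unitaryGroup (Bits n) ℂ) where
  carrier := {U | ∃ (k : ℕ) (a b : Bits n),
    (U : Matrix (Bits n) (Bits n) ℂ) = (Complex.I ^ k) • pauliMatrix a b}
  one_mem' := ⟨0, 0, 0, by simp [pauliMatrix_zero]⟩
  mul_mem' := by
    rintro U V ⟨k, a, b, hU⟩ ⟨l, c, e, hV⟩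
    refine ⟨k + l + 2 * (b ⬝ᵥ c).val, a + c, b + e, ?_⟩
    rw [Matrix.UnitaryGroup.mul_val, hU, hV, Matrix.smul_mul, Matrix.mul_smul, pauliMatrix_mul,
      smul_smul, smul_smul, pow_add, pow_add, pow_mul, Complex.I_sq]
  inv_mem' := by
    rintro U ⟨k, a, b, hU⟩
    refine ⟨3 * k + 2 * (b ⬝ᵥ a).val, a, b, ?_⟩
    have h : (U : Matrix (Bits n) (Bits n) ℂ) *
        ((Complex.I ^ (3 * k + 2 * (b ⬝ᵥ a).val)) • pauliMatrix a b) = 1 := by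
      rw [hU, Matrix.smul_mul, Matrix.mul_smul, pauliMatrix_mul, smul_smul, smul_smul,
        bits_add_self, bits_add_self, pauliMatrix_zero, pow_add, pow_mul Complex.I 2,
        Complex.I_sq, ← mul_assoc, ← pow_add, mul_assoc, ← mul_pow,
        show k + 3 * k = 4 * k by ring, pow_mul, Complex.I_pow_four]
      simp
    have h2 : ((U⁻¹ : Matrix.unitaryGroup (Bits n) ℂ) : Matrix (Bits n) (Bits n) ℂ) *
        (U : Matrix (Bits n) (Bits n) ℂ) = 1 := by
      rw [← Matrix.UnitaryGroup.mul_val, inv_mul_cancel, Matrix.UnitaryGroup.one_val]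
    exact left_inv_eq_right_inv h2 h

theorem finite_pauliGroup (n : ℕ) : (pauliGroup n : Set (Matrix.unitaryGroup (Bits n) ℂ)).Finite := by
  have hfin : (Set.range fun p : Fin 4 × Bits n × Bits n =>
      (Complex.I ^ (p.1 : ℕ)) • pauliMatrix p.2.1 p.2.2).Finite := Set.finite_range _
  refine (hfin.preimage (f := Subtype.val) Subtype.val_injective.injOn).subset ?_
  rintro U ⟨k, a, b, hU⟩
  refine ⟨(⟨k % 4, Nat.mod_lt _ (by norm_num)⟩, a, b), ?_⟩
  change (Complex.I ^ (k % 4)) • pauliMatrix a b = _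
  rw [hU, ← Complex.I_pow_eq_pow_mod]

/-- The `n`-qubit Clifford group: the normalizer of the Pauli group in the unitary group. -/
def cliffordGroup (n : ℕ) : Subgroup (Matrix.unitaryGroup (Bits n) ℂ) :=
  Subgroup.normalizer (pauliGroup n : Set (Matrix.unitaryGroup (Bits n) ℂ))

theorem isClosed_normalizer_of_finite {G : Type*} [Group G] [TopologicalSpace G]
    [IsTopologicalGroup G] [T1Space G] (H : Subgroup G) (hH : (H : Set G).Finite) :
    IsClosed (Subgroup.normalizer (H : Set G) : Set G) := by
  have h : (Subgroup.normalizer (H : Set G) : Set G) =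
      ⋂ p ∈ H, {g : G | g * p * g⁻¹ ∈ (H : Set G)} ∩ {g : G | g⁻¹ * p * g ∈ (H : Set G)} := by
    ext g
    simp only [SetLike.mem_coe, Subgroup.mem_normalizer_iff, Set.mem_iInter, Set.mem_inter_iff,
      Set.mem_ofPred_eq]
    refine ⟨fun hg p hp => ⟨(hg p).1 hp, (hg _).2 ?_⟩,
      fun hg p => ⟨fun hp => (hg p hp).1, fun hp => ?_⟩⟩
    · simpa [mul_assoc] using hp
    · simpa [mul_assoc] using (hg _ hp).2
  rw [h]
  exact isClosed_biInter fun p _ => IsClosed.inter (hH.isClosed.preimage (by fun_prop))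
    (hH.isClosed.preimage (by fun_prop))

theorem isClosed_cliffordGroup (n : ℕ) :
    IsClosed (cliffordGroup n : Set (Matrix.unitaryGroup (Bits n) ℂ)) :=
  isClosed_normalizer_of_finite _ (finite_pauliGroup n)

instance instCompactSpaceCliffordGroup (n : ℕ) : CompactSpace (cliffordGroup n) :=
  isCompact_iff_compactSpace.mp (isClosed_cliffordGroup n).isCompact

/-! ### Twirls, diamond distance and designs -/

section Designs

variable {ι κ : Type*} [Fintype ι] [DecidableEq ι] [Fintype κ] [DecidableEq κ]

/-- The tensor power `U^{⊗ t}`, a matrix indexed by `t`-tuples of basis labels. -/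
def tensorPow (t : ℕ) (U : Matrix ι ι ℂ) : Matrix (Fin t → ι) (Fin t → ι) ℂ :=
  Matrix.of fun x y => ∏ i, U (x i) (y i)

/-- The `t`-wise twirl `A ↦ 𝔼_{R ∼ ν} R^{⊗ t} A (R^{⊗ t})†`; the expectation of the random matrix is
taken entry by entry. -/
def twirl (ν : Measure (Matrix.unitaryGroup ι ℂ)) (t : ℕ) (A : Matrix (Fin t → ι) (Fin t → ι) ℂ) :
    Matrix (Fin t → ι) (Fin t → ι) ℂ :=
  Matrix.of fun x y => ∫ R, (tensorPow t (R : Matrix ι ι ℂ) * A *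
    (tensorPow t (R : Matrix ι ι ℂ))ᴴ) x y ∂ν

/-- The trace norm `‖A‖₁ = Tr √(A† A)`, the sum of the square roots of the eigenvalues of
`A† A`. -/
def traceNorm (A : Matrix κ κ ℂ) : ℝ :=
  ∑ i, √((Matrix.isHermitian_conjTranspose_mul_self A).eigenvalues i)

/-- `M ⊗ id` for a map `M` on matrices indexed by `κ`: it applies `M` to each block of a matrix
on the tensor product with a second register indexed by `η`. -/
def extendById {η : Type*} (M : Matrix κ κ ℂ → Matrix κ κ ℂ) (O : Matrix (κ × η) (κ × η) ℂ) :
    Matrix (κ × η) (κ × η) ℂ :=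
  Matrix.of fun p q => M (Matrix.of fun a b => O (a, p.2) (b, q.2)) p.1 q.1

/-- The projector `|ψ⟩⟨ψ|`. -/
def proj (ψ : EuclideanSpace ℂ κ) : Matrix κ κ ℂ :=
  Matrix.of fun x y => ψ x * star (ψ y)

/-- The diamond distance: the supremum over unit vectors `ψ` of `H ⊗ H` of
`‖(M ⊗ id)(|ψ⟩⟨ψ|) - (N ⊗ id)(|ψ⟩⟨ψ|)‖₁`. -/
def diamondDist (M N : Matrix κ κ ℂ → Matrix κ κ ℂ) : ℝ≥0∞ :=
  ⨆ (ψ : EuclideanSpace ℂ (κ × κ)) (_ : ‖ψ‖ = 1),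
    ENNReal.ofReal (traceNorm (extendById M (proj ψ) - extendById N (proj ψ)))

/-- `ν` is a diamond `ε`-approximate `t`-design. -/
def IsDiamondApproxDesign (ν : Measure (Matrix.unitaryGroup ι ℂ)) (t : ℕ) (ε : ℝ) : Prop :=
  diamondDist (twirl ν t) (twirl (haarProb (Matrix.unitaryGroup ι ℂ)) t) ≤ ENNReal.ofReal ε

end Designs

/-- The law of `P_π F_f C`, for `π ∼ D`, `f ∼ F` and a uniformly (Haar) random element `C` of the
`n`-qubit Clifford group, drawn independently. -/
def pfcEnsemble (n : ℕ) (D : PMF (Equiv.Perm (Bits n))) (F : PMF (Bits n → ZMod 2)) :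
    Measure (Matrix.unitaryGroup (Bits n) ℂ) :=
  ∑ π, ∑ f, (D π * F f) •
    Measure.map (fun C : cliffordGroup n => permOp π * phaseOp f * (C : Matrix.unitaryGroup (Bits n) ℂ))
      (haarProb (cliffordGroup n))

end

/-!
By duality between the trace norm and the operator norm it suffices to compare `𝔼 ⟨φ_R|W|φ_R⟩`,
`φ_R = (R^{⊗ t} ⊗ 1) φ`, for `R` from the ensemble and for Haar random `R`, where `W` is a
contraction and `φ` a unit vector. Haar measure is left invariant, so it is itself the law of
`P_π F_f U` with Haar random `U`. Both expectations are compared with one quadratic form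
`meanForm W`, which models averaging over uniformly random `π` and `f`. It depends on `φ` only
through an unweighted sum over all label tuples, which is a trace and hence does not change under
`φ ↦ (U^{⊗ t} ⊗ 1) φ`.

On vectors supported on tuples of distinct labels, `2t`-wise independence of `f` kills all cross
terms between tuples that are not reorderings of each other, and approximate `t`-wise independence
of `π` replaces the labels by uniform ones up to an error `δ d(d-1)⋯(d-t+1)`; the result is
`meanForm W`. What remains is the weight of `(U^{⊗ t} ⊗ 1) φ` on tuples with a repeated label. For a
law invariant under left multiplication by Clifford unitaries its mean is unchanged when `U` is
multiplied by `H^{⊗ n}` times a random diagonal unitary `i^{g(x)}` with `g` quadratic. The random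
phases remove all matrix elements of the collision projection of two registers except those between
`(y₁, y₂)` and `(y₁, y₂)` or `(y₂, y₁)`, each of which is at most `1 / d` in absolute value, so by
the Schur test every pair of registers collides with probability at most `2 / d`. Hence the weight
is at most `2 t² / d`, and dropping that part costs `O(√(t² / d)) = O(t / √d)`.
-/

noncomputable section

open scoped InnerProductSpace Kronecker Matrix.Norms.L2Operator

/-! ### Averages over finite probability distributions -/

section PMFMean

variable {α β : Type*} [Fintype α]

/-- The expectation of a complex-valued function of a finite random variable with law `p`. -/
def pmfMean (p : PMF α) (h : α → ℂ) : ℂ :=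
  ∑ a, ((p a).toReal : ℂ) * h a

theorem sum_toReal_pmf (p : PMF α) : ∑ a, (p a).toReal = 1 := by
  rw [← ENNReal.toReal_sum fun a _ => p.apply_ne_top a, ← tsum_fintype (L := .unconditional α),
    p.tsum_coe, ENNReal.toReal_one]

theorem pmfMean_sub (p : PMF α) (g h : α → ℂ) :
    pmfMean p (fun a => g a - h a) = pmfMean p g - pmfMean p h := by
  simp only [pmfMean, mul_sub, Finset.sum_sub_distrib]

theorem pmfMean_mul_right (p : PMF α) (h : α → ℂ) (c : ℂ) :
    pmfMean p (fun a => h a * c) = pmfMean p h * c := by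
  simp only [pmfMean, Finset.sum_mul, mul_assoc]

theorem pmfMean_sum (p : PMF α) (s : Finset β) (h : β → α → ℂ) :
    pmfMean p (fun a => ∑ b ∈ s, h b a) = ∑ b ∈ s, pmfMean p (h b) := by
  simp only [pmfMean, Finset.mul_sum]
  exact Finset.sum_comm

theorem norm_pmfMean_le (p : PMF α) {h : α → ℂ} {B : ℝ} (hB : ∀ a, ‖h a‖ ≤ B) :
    ‖pmfMean p h‖ ≤ B :=
  calc ‖pmfMean p h‖ ≤ ∑ a, (p a).toReal * B := by
        refine norm_sum_le_of_le _ fun a _ => ?_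
        rw [norm_mul, Complex.norm_real, Real.norm_of_nonneg ENNReal.toReal_nonneg]
        exact mul_le_mul_of_nonneg_left (hB a) ENNReal.toReal_nonneg
    _ = B := by rw [← Finset.sum_mul, sum_toReal_pmf, one_mul]

theorem pmfMean_comp [Fintype β] (p : PMF α) (X : α → β) (g : β → ℂ) :
    pmfMean p (fun a => g (X a)) =
      ∑ b, ((p.toOuterMeasure {a | X a = b}).toReal : ℂ) * g b := by
  classical
  have hlaw (b : β) : (p.toOuterMeasure {a | X a = b}).toReal =
      ∑ a, if X a = b then (p a).toReal else 0 := by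
    rw [PMF.toOuterMeasure_apply_fintype, ENNReal.toReal_sum fun a _ =>
      ne_top_of_le_ne_top (p.apply_ne_top a) (Set.indicator_le_self' (fun _ _ => zero_le) a)]
    refine Finset.sum_congr rfl fun a _ => ?_
    by_cases h : X a = b <;> simp [h]
  simp only [hlaw, Complex.ofReal_sum, Finset.sum_mul]
  rw [Finset.sum_comm]
  refine Finset.sum_congr rfl fun a _ => ?_
  rw [Finset.sum_eq_single (X a) (fun b _ hb => by simp [hb.symm]) (by simp), if_pos rfl]

end PMFMean

section Independence

variable {α β : Type*} [Fintype α] [DecidableEq α] [Fintype β] {t : ℕ} {F : PMF (α → β)}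

theorem IsTWiseIndependent.pmfMean_comp (hF : IsTWiseIndependent t F) {x : Fin t → α}
    (hx : Function.Injective x) (g : (Fin t → β) → ℂ) :
    pmfMean F (fun f => g (f ∘ x)) = ((Fintype.card β : ℂ) ^ t)⁻¹ * ∑ y, g y := by
  rw [_root_.pmfMean_comp F (fun f => f ∘ x) g, Finset.mul_sum]
  refine Finset.sum_congr rfl fun y _ => ?_
  have hevent : {f : α → β | f ∘ x = y} = {f | ∀ i, f (x i) = y i} :=
    Set.ext fun f => funext_iff
  rw [hevent, hF x y hx]
  push_cast
  rfl

theorem IsTWiseIndependent.pmfMean_prod [Nonempty β] (hF : IsTWiseIndependent t F) {S : Finset α}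
    (hS : S.card ≤ t) (ht : t ≤ Fintype.card α) (h : α → β → ℂ) :
    pmfMean F (fun f => ∏ a ∈ S, h a (f a)) =
      ∏ a ∈ S, (Fintype.card β : ℂ)⁻¹ * ∑ b, h a b := by
  obtain ⟨T, hST, rfl⟩ := Finset.exists_superset_card_eq hS ht
  set x : Fin T.card → α := fun i => T.equivFin.symm i
  have hx : Function.Injective x := Subtype.val_injective.comp T.equivFin.symm.injective
  have hprod_enum (k : α → ℂ) : ∏ i, (if x i ∈ S then k (x i) else 1) = ∏ a ∈ S, k a := by
    rw [T.equivFin.symm.prod_comp (fun a : T => if (a : α) ∈ S then k a else 1),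
      Finset.prod_coe_sort T fun a => if a ∈ S then k a else 1, Finset.prod_ite_mem,
      Finset.inter_eq_right.mpr hST]
  have hβ : (Fintype.card β : ℂ) ≠ 0 := Nat.cast_ne_zero.mpr Fintype.card_ne_zero
  calc pmfMean F (fun f => ∏ a ∈ S, h a (f a))
      = pmfMean F (fun f => ∏ i, if x i ∈ S then h (x i) ((f ∘ x) i) else 1) := by
        simp only [← hprod_enum, Function.comp_apply]
    _ = ((Fintype.card β : ℂ) ^ T.card)⁻¹ *
          ∑ y : Fin T.card → β, ∏ i, if x i ∈ S then h (x i) (y i) else 1 :=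
        hF.pmfMean_comp hx fun y => ∏ i, if x i ∈ S then h (x i) (y i) else 1
    _ = ∏ i, if x i ∈ S then (Fintype.card β : ℂ)⁻¹ * ∑ b, h (x i) b else 1 := by
        rw [← Fintype.prod_sum (fun i b => if x i ∈ S then h (x i) b else 1), ← inv_pow,
          ← Fin.prod_const, ← Finset.prod_mul_distrib]
        refine Finset.prod_congr rfl fun i _ => ?_
        split_ifs <;> simp [hβ]
    _ = _ := hprod_enum fun a => (Fintype.card β : ℂ)⁻¹ * ∑ b, h a b

end Independence

section PhaseSign

/-- The nontrivial character `u ↦ (-1) ^ u` of `ZMod 2`. -/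
def signChar : AddChar (ZMod 2) ℂ :=
  AddChar.zmodChar 2 (neg_one_sq : (-1 : ℂ) ^ 2 = 1)

theorem signChar_apply (u : ZMod 2) : signChar u = (-1) ^ u.val :=
  AddChar.zmodChar_apply _ u

theorem signChar_sq (u : ZMod 2) : signChar u ^ 2 = 1 := by
  rw [signChar_apply, ← pow_mul, mul_comm, pow_mul, neg_one_sq, one_pow]

theorem star_signChar (u : ZMod 2) : star (signChar u) = signChar u := by
  simp only [signChar_apply, star_pow, star_neg, star_one]

theorem sum_signChar : ∑ u, signChar u = 0 :=
  AddChar.sum_eq_zero_of_ne_one <| ne_of_apply_ne (· 1) <| by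
    simp only [signChar_apply, ZMod.val_one, pow_one, AddChar.one_apply]
    norm_num

variable {ι : Type*} {t : ℕ}

/-- The sign picked up by the basis state `|x₁⟩ ⊗ ⋯ ⊗ |x_t⟩` under `F_f^{⊗ t}`. -/
def phaseSign (f : ι → ZMod 2) (x : Fin t → ι) : ℂ :=
  ∏ i, signChar (f (x i))

theorem star_phaseSign (f : ι → ZMod 2) (x : Fin t → ι) :
    star (phaseSign f x) = phaseSign f x := by
  simp only [phaseSign, star_prod, star_signChar]

theorem phaseSign_eq_prod_map (f : ι → ZMod 2) (x : Fin t ↪ ι) :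
    phaseSign f x = ∏ a ∈ Finset.univ.map x, signChar (f a) := by
  rw [Finset.prod_map, phaseSign]

theorem prod_signChar_mul_prod_signChar [DecidableEq ι] (f : ι → ZMod 2) (S T : Finset ι) :
    (∏ a ∈ S, signChar (f a)) * ∏ a ∈ T, signChar (f a) =
      ∏ a ∈ symmDiff S T, signChar (f a) := by
  have hinter : (∏ a ∈ S ∩ T, signChar (f a)) ^ 2 = 1 := by
    simp only [← Finset.prod_pow, signChar_sq, Finset.prod_const_one]
  rw [symmDiff_def, Finset.sup_eq_union, Finset.prod_union disjoint_sdiff_sdiff,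
    ← Finset.prod_inter_mul_prod_sdiff S T, ← Finset.prod_inter_mul_prod_sdiff T S,
    Finset.inter_comm T S]
  linear_combination (∏ a ∈ S \ T, signChar (f a)) * (∏ a ∈ T \ S, signChar (f a)) * hinter

theorem pmfMean_phaseSign_mul [Fintype ι] [DecidableEq ι] {F : PMF (ι → ZMod 2)}
    (hF : IsTWiseIndependent (2 * t) F)
    (ht : 2 * t ≤ Fintype.card ι) (x y : Fin t ↪ ι) :
    pmfMean F (fun f => phaseSign f x * phaseSign f y) =
      if Finset.univ.map x = Finset.univ.map y then 1 else 0 := by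
  set S := symmDiff (Finset.univ.map x) (Finset.univ.map y)
  have hcard : S.card ≤ 2 * t := by
    refine (Finset.card_le_card Finset.symmDiff_subset_union).trans
      ((Finset.card_union_le _ _).trans ?_)
    simp [two_mul]
  simp only [phaseSign_eq_prod_map, prod_signChar_mul_prod_signChar]
  rw [hF.pmfMean_prod hcard ht fun _ => signChar, sum_signChar, mul_zero]
  split_ifs with h
  · simp [S, h]
  · obtain ⟨a, ha⟩ := Finset.symmDiff_nonempty.mpr h
    exact Finset.prod_eq_zero ha rfl

end PhaseSign

/-! ### Trace norm duality -/

section TraceNorm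

variable {κ : Type*} [Fintype κ] [DecidableEq κ]

theorem l2_opNorm_unitary_conj_diagonal (V : Matrix.unitaryGroup κ ℂ) (v : κ → ℂ) :
    ‖(V : Matrix κ κ ℂ) * Matrix.diagonal v * (V : Matrix κ κ ℂ)ᴴ‖ = ‖v‖ := by
  rw [← Matrix.star_eq_conjTranspose, ← Unitary.coe_star, CStarRing.norm_mul_coe_unitary,
    CStarRing.norm_coe_unitary_mul, Matrix.l2_opNorm_diagonal]

theorem unitary_conj_mul_unitary_conj (V : Matrix.unitaryGroup κ ℂ) (A B : Matrix κ κ ℂ) :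
    (V : Matrix κ κ ℂ) * A * (V : Matrix κ κ ℂ)ᴴ * (V * B * (V : Matrix κ κ ℂ)ᴴ) =
      V * (A * B) * (V : Matrix κ κ ℂ)ᴴ := by
  have hV : (V : Matrix κ κ ℂ)ᴴ * V = 1 := Matrix.mem_unitaryGroup_iff'.mp V.2
  simp only [Matrix.mul_assoc]
  rw [← Matrix.mul_assoc _ _ (B * _), hV, Matrix.one_mul]

theorem exists_norm_le_one_trace_mul_eq_traceNorm (A : Matrix κ κ ℂ) :
    ∃ W : Matrix κ κ ℂ, ‖W‖ ≤ 1 ∧ (W * A).trace = traceNorm A := by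
  have hH := Matrix.isHermitian_conjTranspose_mul_self A
  set V := hH.eigenvectorUnitary
  set lam := hH.eigenvalues
  set s : κ → ℂ := fun i => ((√(lam i))⁻¹ : ℝ)
  set S : Matrix κ κ ℂ := V * Matrix.diagonal s * (V : Matrix κ κ ℂ)ᴴ with hS
  have hspec : Aᴴ * A = V * Matrix.diagonal (fun i => (lam i : ℂ)) * (V : Matrix κ κ ℂ)ᴴ :=
    hH.spectral_theorem
  have hSH : Sᴴ = S := by
    rw [hS, Matrix.conjTranspose_mul, Matrix.conjTranspose_mul, Matrix.conjTranspose_conjTranspose,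
      Matrix.diagonal_conjTranspose, Matrix.mul_assoc]
    congr 3
    funext i
    exact Complex.conj_ofReal _
  have hsqrt (i : κ) : s i * lam i = √(lam i) := by
    rw [← Complex.ofReal_mul, inv_mul_eq_div, Real.div_sqrt]
  refine ⟨S * Aᴴ, ?_, ?_⟩
  · have hgram : S * Aᴴ * (S * Aᴴ)ᴴ =
        V * Matrix.diagonal (fun i => s i * lam i * s i) * (V : Matrix κ κ ℂ)ᴴ := by
      rw [Matrix.conjTranspose_mul, Matrix.conjTranspose_conjTranspose, hSH, Matrix.mul_assoc,
        ← Matrix.mul_assoc Aᴴ, hspec, hS, ← Matrix.mul_assoc, unitary_conj_mul_unitary_conj,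
        unitary_conj_mul_unitary_conj, Matrix.diagonal_mul_diagonal, Matrix.diagonal_mul_diagonal]
    have hsq : ‖S * Aᴴ‖ * ‖S * Aᴴ‖ ≤ 1 := by
      rw [← CStarRing.norm_self_mul_star, Matrix.star_eq_conjTranspose, hgram,
        l2_opNorm_unitary_conj_diagonal]
      refine (pi_norm_le_iff_of_nonneg zero_le_one).mpr fun i => ?_
      rw [hsqrt, ← Complex.ofReal_mul, Complex.norm_real,
        Real.norm_of_nonneg (mul_nonneg (Real.sqrt_nonneg _) (inv_nonneg.mpr (Real.sqrt_nonneg _)))]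
      exact mul_inv_le_one
    nlinarith [norm_nonneg (S * Aᴴ)]
  · rw [Matrix.mul_assoc, hspec, hS, unitary_conj_mul_unitary_conj, Matrix.diagonal_mul_diagonal,
      Matrix.trace_mul_cycle, ← Matrix.star_eq_conjTranspose, Unitary.coe_star_mul_self,
      one_mul, Matrix.trace_diagonal]
    simp only [hsqrt, traceNorm, Complex.ofReal_sum]
    rfl

end TraceNorm

/-! ### Vectors of bipartite systems and tensor powers -/

section ExpectationValue

variable {E : Type*} [NormedAddCommGroup E] [InnerProductSpace ℂ E]

/-- The quadratic form `⟨v|W|v⟩` of an operator, the expectation value of `W` in the state `v`. -/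
def expectationValue (W : E →L[ℂ] E) (v : E) : ℂ :=
  ⟪v, W v⟫_ℂ

theorem norm_expectationValue_le (W : E →L[ℂ] E) (v : E) :
    ‖expectationValue W v‖ ≤ ‖W‖ * ‖v‖ ^ 2 :=
  calc ‖⟪v, W v⟫_ℂ‖ ≤ ‖v‖ * (‖W‖ * ‖v‖) :=
        (norm_inner_le_norm _ _).trans (by gcongr; exact W.le_opNorm v)
    _ = ‖W‖ * ‖v‖ ^ 2 := by ring

theorem norm_expectationValue_sub_le (W : E →L[ℂ] E) (u v : E) :
    ‖expectationValue W u - expectationValue W v‖ ≤ ‖W‖ * ((‖u‖ + ‖v‖) * ‖u - v‖) := by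
  have hsplit : expectationValue W u - expectationValue W v =
      ⟪u, W (u - v)⟫_ℂ + ⟪u - v, W v⟫_ℂ := by
    rw [expectationValue, expectationValue, map_sub, inner_sub_right, inner_sub_left]
    ring
  calc ‖expectationValue W u - expectationValue W v‖
      ≤ ‖u‖ * (‖W‖ * ‖u - v‖) + ‖u - v‖ * (‖W‖ * ‖v‖) := by
        rw [hsplit]
        refine (norm_add_le _ _).trans (add_le_add ?_ ?_) <;>
        · refine (norm_inner_le_norm _ _).trans ?_
          gcongr
          exact W.le_opNorm _
    _ = _ := by ring

variable {α : Type*} [Fintype α]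

theorem sum_expectationValue_mix (W : E →L[ℂ] E) (s : Finset α) (T : Matrix α α ℂ) (v : α → E) :
    ∑ x ∈ s, expectationValue W (∑ a, T x a • v a) =
      ∑ a, ∑ b, (∑ x ∈ s, star (T x a) * T x b) * ⟪v a, W (v b)⟫_ℂ := by
  simp only [expectationValue, map_sum, map_smul, sum_inner, inner_smul_left]
  simp only [inner_sum, inner_smul_right, Finset.mul_sum, Finset.sum_mul, starRingEnd_apply,
    mul_assoc]
  rw [Finset.sum_comm]
  exact Finset.sum_congr rfl fun a _ => Finset.sum_comm

theorem sum_expectationValue_unitary_mix [DecidableEq α] (W : E →L[ℂ] E) {T : Matrix α α ℂ}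
    (hT : T ∈ Matrix.unitaryGroup α ℂ) (v : α → E) :
    ∑ x, expectationValue W (∑ a, T x a • v a) = ∑ x, expectationValue W (v x) := by
  have hcols (a b : α) : ∑ x, star (T x a) * T x b = if a = b then 1 else 0 := by
    have h := congrFun₂ (Matrix.mem_unitaryGroup_iff'.mp hT) a b
    simpa only [Matrix.mul_apply, Matrix.star_apply, Matrix.one_apply] using h
  rw [sum_expectationValue_mix]
  simp only [hcols, ite_mul, one_mul, zero_mul, Finset.sum_ite_eq, Finset.mem_univ, if_true,
    expectationValue]

end ExpectationValue

section Slice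

variable {α η : Type*}

/-- The component `(⟨x| ⊗ 1) φ` of a vector `φ` of a bipartite system along the basis state `x` of
the first register. -/
def slice (x : α) : EuclideanSpace ℂ (α × η) →ₗ[ℂ] EuclideanSpace ℂ η where
  toFun φ := WithLp.toLp 2 fun r => φ (x, r)
  map_add' _ _ := rfl
  map_smul' _ _ := rfl

theorem slice_apply (x : α) (φ : EuclideanSpace ℂ (α × η)) (r : η) : slice x φ r = φ (x, r) :=
  rfl

variable [Fintype α] [Fintype η]

theorem norm_sq_eq_sum_slice (φ : EuclideanSpace ℂ (α × η)) :
    ‖φ‖ ^ 2 = ∑ x : α, ‖slice x φ‖ ^ 2 := by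
  simp only [EuclideanSpace.norm_sq_eq, Fintype.sum_prod_type, slice_apply]

variable [DecidableEq α]

/-- The isometric embedding `v ↦ |x⟩ ⊗ v` of the second register of a bipartite system. -/
def ketTensor (x : α) : EuclideanSpace ℂ η →ₗᵢ[ℂ] EuclideanSpace ℂ (α × η) where
  toFun v := WithLp.toLp 2 fun p => if p.1 = x then v p.2 else 0
  map_add' u v := by ext p; by_cases h : p.1 = x <;> simp [h]
  map_smul' c v := by ext p; by_cases h : p.1 = x <;> simp [h]
  norm_map' v := by
    rw [← sq_eq_sq₀ (norm_nonneg _) (norm_nonneg _), EuclideanSpace.norm_sq_eq,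
      EuclideanSpace.norm_sq_eq, Fintype.sum_prod_type,
      Finset.sum_eq_single x (fun y _ hy => by simp [hy]) (by simp)]
    simp

theorem ketTensor_apply (x : α) (v : EuclideanSpace ℂ η) (p : α × η) :
    ketTensor x v p = if p.1 = x then v p.2 else 0 :=
  rfl

theorem slice_ketTensor (x y : α) (v : EuclideanSpace ℂ η) :
    slice y (ketTensor x v) = if y = x then v else 0 := by
  ext r
  rw [slice_apply, ketTensor_apply]
  split_ifs <;> rfl

theorem orthogonalFamily_ketTensor :
    OrthogonalFamily ℂ (fun _ : α => EuclideanSpace ℂ η) ketTensor := by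
  intro x y hxy u v
  rw [PiLp.inner_apply]
  refine Finset.sum_eq_zero fun p _ => ?_
  simp only [ketTensor_apply]
  split_ifs with hx hy
  · exact absurd (hx.symm.trans hy) hxy
  all_goals simp

end Slice

section TensorAction

variable {ι η : Type*} {t : ℕ}

theorem tensorPow_mul [Fintype ι] (U V : Matrix ι ι ℂ) :
    tensorPow t (U * V) = tensorPow t U * tensorPow t V := by
  ext x z
  simp only [tensorPow, Matrix.mul_apply, Matrix.of_apply, ← Finset.prod_mul_distrib]
  exact Fintype.prod_sum fun i y => U (x i) y * V y (z i)

theorem tensorPow_one [DecidableEq ι] : tensorPow t (1 : Matrix ι ι ℂ) = 1 := by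
  ext x y
  simp only [tensorPow, Matrix.of_apply, Matrix.one_apply, Fintype.prod_ite_zero,
    Finset.prod_const_one, funext_iff]

theorem tensorPow_conjTranspose (U : Matrix ι ι ℂ) : (tensorPow t U)ᴴ = tensorPow t Uᴴ := by
  ext x y
  simp [tensorPow, Matrix.conjTranspose_apply, star_prod]

theorem tensorPow_comp_perm (U : Matrix ι ι ℂ) (x y : Fin t → ι) (σ : Equiv.Perm (Fin t)) :
    tensorPow t U (x ∘ σ) (y ∘ σ) = tensorPow t U x y :=
  Equiv.prod_comp σ fun i => U (x i) (y i)

variable [Fintype ι] [DecidableEq ι]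

theorem tensorPow_mem_unitaryGroup (U : Matrix.unitaryGroup ι ℂ) :
    tensorPow t (U : Matrix ι ι ℂ) ∈ Matrix.unitaryGroup (Fin t → ι) ℂ := by
  rw [Matrix.mem_unitaryGroup_iff, Matrix.star_eq_conjTranspose, tensorPow_conjTranspose,
    ← tensorPow_mul, ← Matrix.star_eq_conjTranspose,
    Matrix.mem_unitaryGroup_iff.mp U.2, tensorPow_one]

variable [Fintype η] [DecidableEq η]

/-- The action `U^{⊗ t} ⊗ 1` of a unitary on `t` registers together with an idle register. -/
def tensorAction (U : Matrix.unitaryGroup ι ℂ) :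
    EuclideanSpace ℂ ((Fin t → ι) × η) →L[ℂ] EuclideanSpace ℂ ((Fin t → ι) × η) :=
  Matrix.toEuclideanCLM (𝕜 := ℂ) (tensorPow t (U : Matrix ι ι ℂ) ⊗ₖ (1 : Matrix η η ℂ))

theorem tensorAction_mul (U V : Matrix.unitaryGroup ι ℂ) (φ : EuclideanSpace ℂ ((Fin t → ι) × η)) :
    tensorAction (U * V) φ = tensorAction U (tensorAction V φ) := by
  have hkron : tensorPow t (U * V : Matrix ι ι ℂ) ⊗ₖ (1 : Matrix η η ℂ) =
      (tensorPow t (U : Matrix ι ι ℂ) ⊗ₖ 1) * (tensorPow t (V : Matrix ι ι ℂ) ⊗ₖ 1) := by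
    rw [tensorPow_mul, ← Matrix.mul_kronecker_mul, one_mul]
  simp only [tensorAction, Matrix.UnitaryGroup.mul_val, hkron, map_mul]
  rfl

theorem tensorAction_apply (U : Matrix.unitaryGroup ι ℂ) (φ : EuclideanSpace ℂ ((Fin t → ι) × η))
    (x : Fin t → ι) (r : η) :
    tensorAction U φ (x, r) = ∑ a, tensorPow t (U : Matrix ι ι ℂ) x a * φ (a, r) := by
  simp [tensorAction, Matrix.mulVec, dotProduct, Fintype.sum_prod_type, Matrix.one_apply]

theorem slice_tensorAction (U : Matrix.unitaryGroup ι ℂ) (φ : EuclideanSpace ℂ ((Fin t → ι) × η))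
    (x : Fin t → ι) :
    slice x (tensorAction U φ) = ∑ a, tensorPow t (U : Matrix ι ι ℂ) x a • slice a φ := by
  ext r
  simp [slice_apply, tensorAction_apply]

theorem norm_tensorAction (U : Matrix.unitaryGroup ι ℂ) (φ : EuclideanSpace ℂ ((Fin t → ι) × η)) :
    ‖tensorAction U φ‖ = ‖φ‖ := by
  have h := sum_expectationValue_unitary_mix (.id ℂ _) (tensorPow_mem_unitaryGroup (t := t) U)
    fun x => slice x φ
  simp only [← slice_tensorAction, expectationValue, ContinuousLinearMap.id_apply,
    inner_self_eq_norm_sq_to_K] at h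
  rw [← sq_eq_sq₀ (norm_nonneg _) (norm_nonneg _), norm_sq_eq_sum_slice, norm_sq_eq_sum_slice φ]
  exact_mod_cast h

theorem continuous_tensorAction (φ : EuclideanSpace ℂ ((Fin t → ι) × η)) :
    Continuous fun U : Matrix.unitaryGroup ι ℂ => tensorAction U φ := by
  refine (PiLp.continuous_toLp 2 _).comp (continuous_pi fun ⟨x, r⟩ => ?_)
  have hentry (i j : ι) : Continuous fun U : Matrix.unitaryGroup ι ℂ => (U : Matrix ι ι ℂ) i j :=
    (continuous_subtype_val (X := Matrix ι ι ℂ)).matrix_elem i j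
  change Continuous fun U : Matrix.unitaryGroup ι ℂ => tensorAction U φ (x, r)
  simp only [tensorAction_apply, tensorPow, Matrix.of_apply]
  exact continuous_finsetSum _ fun a _ =>
    (continuous_finsetProd _ fun i _ => hentry (x i) (a i)).mul continuous_const

end TensorAction

section DistinctPart

variable {ι η : Type*} [Fintype ι] [DecidableEq ι] [Fintype η] {t : ℕ}

theorem sum_ite_injective {M : Type*} [AddCommMonoid M] (g : (Fin t → ι) → M) :
    ∑ x, (if Function.Injective x then g x else 0) = ∑ x : Fin t ↪ ι, g x := by
  rw [← Finset.sum_filter, Finset.sum_subtype (p := Function.Injective) _ (by simp)]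
  exact (Equiv.subtypeInjectiveEquivEmbedding (Fin t) ι).sum_comp fun x => g x

/-- The orthogonal projection of `φ` onto the span of the basis states with pairwise distinct
labels `x₁, …, x_t`. -/
def distinctPart (φ : EuclideanSpace ℂ ((Fin t → ι) × η)) : EuclideanSpace ℂ ((Fin t → ι) × η) :=
  ∑ x : Fin t ↪ ι, ketTensor ⇑x (slice ⇑x φ)

theorem slice_distinctPart (y : Fin t → ι) (φ : EuclideanSpace ℂ ((Fin t → ι) × η)) :
    slice y (distinctPart φ) = if Function.Injective y then slice y φ else 0 := by
  simp only [distinctPart, map_sum, slice_ketTensor]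
  rw [← sum_ite_injective fun x => if y = x then slice x φ else 0,
    Finset.sum_eq_single y (fun x _ hx => by rw [if_neg hx.symm, ite_self]) (by simp), if_pos rfl]

theorem slice_sub_distinctPart (y : Fin t → ι) (φ : EuclideanSpace ℂ ((Fin t → ι) × η)) :
    slice y (φ - distinctPart φ) = if Function.Injective y then 0 else slice y φ := by
  rw [map_sub, slice_distinctPart]
  split_ifs <;> simp

theorem norm_distinctPart_le (φ : EuclideanSpace ℂ ((Fin t → ι) × η)) :
    ‖distinctPart φ‖ ≤ ‖φ‖ := by
  rw [← sq_le_sq₀ (norm_nonneg _) (norm_nonneg _), norm_sq_eq_sum_slice, norm_sq_eq_sum_slice φ]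
  refine Finset.sum_le_sum fun x _ => ?_
  rw [slice_distinctPart]
  split_ifs
  · rfl
  · simp

end DistinctPart

section Reordering

variable {ι E : Type*} {t : ℕ}

theorem map_univ_eq_map_univ_iff (x y : Fin t ↪ ι) :
    Finset.univ.map x = Finset.univ.map y ↔
      ∃ σ : Equiv.Perm (Fin t), σ.toEmbedding.trans x = y := by
  constructor
  · intro h
    have hrange (i : Fin t) : ∃ j, x j = y i := by
      have hi : y i ∈ Finset.univ.map x := h ▸ Finset.mem_map_of_mem y (Finset.mem_univ i)
      simpa using hi
    choose s hs using hrange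
    have hs_inj : Function.Injective s := fun i j hij => y.injective (by rw [← hs, ← hs, hij])
    exact ⟨.ofBijective s (Finite.injective_iff_bijective.mp hs_inj),
      Function.Embedding.ext hs⟩
  · rintro ⟨σ, rfl⟩
    rw [← Finset.map_map, Finset.map_univ_equiv]

variable [Fintype ι] [AddCommMonoid E]

theorem sum_ite_map_univ_eq [DecidableEq ι] (x : Fin t ↪ ι) (g : (Fin t ↪ ι) → E) :
    ∑ y, (if Finset.univ.map x = Finset.univ.map y then g y else 0) =
      ∑ σ : Equiv.Perm (Fin t), g (σ.toEmbedding.trans x) := by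
  have hinj : Function.Injective fun σ : Equiv.Perm (Fin t) => σ.toEmbedding.trans x :=
    fun σ τ h => Equiv.ext fun i => x.injective (DFunLike.congr_fun h i)
  rw [← Finset.sum_filter, ← Finset.sum_image (f := g) hinj.injOn]
  congr 1
  ext y
  simp [map_univ_eq_map_univ_iff]

theorem sum_trans_reorder (τ : Equiv.Perm (Fin t)) (g : (Fin t ↪ ι) → E) :
    ∑ x : Fin t ↪ ι, g (τ.toEmbedding.trans x) = ∑ x, g x :=
  (Equiv.embeddingCongr τ.symm (Equiv.refl ι)).sum_comp g

end Reordering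

/-! ### Averaging over phases and permutations -/

section PhaseAverage

variable {ι : Type*} [Fintype ι] {t : ℕ}
  {E : Type*} [NormedAddCommGroup E] [InnerProductSpace ℂ E]

theorem pmfMean_expectationValue_phaseSign [DecidableEq ι] {F : PMF (ι → ZMod 2)}
    (hF : IsTWiseIndependent (2 * t) F) (ht : 2 * t ≤ Fintype.card ι) (W : E →L[ℂ] E)
    (v : (Fin t ↪ ι) → E) :
    pmfMean F (fun f => expectationValue W (∑ x : Fin t ↪ ι, phaseSign f x • v x)) =
      ∑ x, ⟪v x, W (∑ σ : Equiv.Perm (Fin t), v (σ.toEmbedding.trans x))⟫_ℂ := by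
  have hexpand (f : ι → ZMod 2) :
      expectationValue W (∑ x : Fin t ↪ ι, phaseSign f x • v x) =
        ∑ x : Fin t ↪ ι, ∑ y : Fin t ↪ ι, phaseSign f x * phaseSign f y * ⟪v x, W (v y)⟫_ℂ := by
    simp only [expectationValue, map_sum, map_smul, sum_inner, inner_smul_left,
      starRingEnd_apply, star_phaseSign]
    simp only [inner_sum, inner_smul_right, Finset.mul_sum, mul_assoc]
  simp only [hexpand, pmfMean_sum, pmfMean_mul_right, pmfMean_phaseSign_mul hF ht, ite_mul,
    one_mul, zero_mul]
  refine Finset.sum_congr rfl fun x _ => ?_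
  rw [sum_ite_map_univ_eq x fun y => ⟪v x, W (v y)⟫_ℂ, map_sum, inner_sum]

theorem sum_expectationValue_symmetrized (W : E →L[ℂ] E) (v : (Fin t ↪ ι) → E) :
    ∑ x, expectationValue W (∑ σ : Equiv.Perm (Fin t), v (σ.toEmbedding.trans x)) =
      t.factorial * ∑ x, ⟪v x, W (∑ σ : Equiv.Perm (Fin t), v (σ.toEmbedding.trans x))⟫_ℂ := by
  set S : (Fin t ↪ ι) → E := fun x => ∑ σ : Equiv.Perm (Fin t), v (σ.toEmbedding.trans x)
  have hS (τ : Equiv.Perm (Fin t)) (x : Fin t ↪ ι) : S (τ.toEmbedding.trans x) = S x :=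
    Equiv.sum_comp (Equiv.mulLeft τ) fun σ : Equiv.Perm (Fin t) => v (σ.toEmbedding.trans x)
  calc ∑ x, expectationValue W (S x)
      = ∑ τ : Equiv.Perm (Fin t), ∑ x,
          ⟪v (τ.toEmbedding.trans x), W (S (τ.toEmbedding.trans x))⟫_ℂ := by
        simp only [expectationValue, hS]
        rw [Finset.sum_comm]
        simp only [S, sum_inner]
    _ = _ := by
        simp only [sum_trans_reorder _ fun x => ⟪v x, W (S x)⟫_ℂ]
        rw [Finset.sum_const, Finset.card_univ, Fintype.card_perm, Fintype.card_fin, nsmul_eq_mul]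

end PhaseAverage

section MeanForm

variable {ι η : Type*} [Fintype ι] [Fintype η] {t : ℕ}

theorem sum_norm_sq_slice_reorder (φ : EuclideanSpace ℂ ((Fin t → ι) × η)) :
    ∑ x : Fin t → ι, ∑ τ : Equiv.Perm (Fin t), ‖slice (x ∘ τ) φ‖ ^ 2 =
      t.factorial * ‖φ‖ ^ 2 := by
  have hreorder (τ : Equiv.Perm (Fin t)) :
      ∑ x : Fin t → ι, ‖slice (x ∘ τ) φ‖ ^ 2 = ‖φ‖ ^ 2 := by
    rw [norm_sq_eq_sum_slice φ]
    exact (τ.symm.arrowCongr (Equiv.refl ι)).sum_comp fun x => ‖slice x φ‖ ^ 2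
  rw [Finset.sum_comm]
  simp only [hreorder, Finset.sum_const, Finset.card_univ, Fintype.card_perm, Fintype.card_fin,
    nsmul_eq_mul]

variable [DecidableEq ι]

/-- The map `φ ↦ ∑_τ |x'τ⟩ ⊗ φ_{xτ}`, which moves the slices of `φ` along the reorderings of the
tuple `x` to the corresponding reorderings of the tuple `x'`. -/
def orbitTransfer (x' x : Fin t → ι) :
    EuclideanSpace ℂ ((Fin t → ι) × η) →ₗ[ℂ] EuclideanSpace ℂ ((Fin t → ι) × η) :=
  ∑ τ : Equiv.Perm (Fin t), (ketTensor (x' ∘ τ)).toLinearMap ∘ₗ slice (x ∘ τ)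

theorem orbitTransfer_apply (x' x : Fin t → ι) (φ : EuclideanSpace ℂ ((Fin t → ι) × η)) :
    orbitTransfer x' x φ = ∑ τ : Equiv.Perm (Fin t), ketTensor (x' ∘ τ) (slice (x ∘ τ) φ) := by
  simp [orbitTransfer]

theorem norm_sq_orbitTransfer (x' : Fin t ↪ ι) (x : Fin t → ι)
    (φ : EuclideanSpace ℂ ((Fin t → ι) × η)) :
    ‖orbitTransfer x' x φ‖ ^ 2 = ∑ τ : Equiv.Perm (Fin t), ‖slice (x ∘ τ) φ‖ ^ 2 := by
  have hinj : Function.Injective fun τ : Equiv.Perm (Fin t) => ⇑x' ∘ ⇑τ := fun σ τ h =>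
    Equiv.ext fun i => x'.injective (congrFun h i)
  rw [orbitTransfer_apply]
  have horth : OrthogonalFamily ℂ (fun _ : Equiv.Perm (Fin t) => EuclideanSpace ℂ η)
      fun τ => ketTensor (x' ∘ τ) := fun _ _ h => orthogonalFamily_ketTensor (hinj.ne h)
  exact horth.norm_sum (fun τ => slice (x ∘ τ) φ) Finset.univ

theorem orbitTransfer_distinctPart (x' x : Fin t → ι) (φ : EuclideanSpace ℂ ((Fin t → ι) × η)) :
    orbitTransfer x' x (distinctPart φ) =
      if Function.Injective x then orbitTransfer x' x φ else 0 := by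
  simp only [orbitTransfer_apply, slice_distinctPart, Equiv.injective_comp]
  split_ifs <;> simp

theorem sum_norm_expectationValue_orbitTransfer_le
    (W : EuclideanSpace ℂ ((Fin t → ι) × η) →L[ℂ] EuclideanSpace ℂ ((Fin t → ι) × η))
    (x' : Fin t ↪ ι) (φ : EuclideanSpace ℂ ((Fin t → ι) × η)) :
    ∑ x, ‖expectationValue W (orbitTransfer x' x φ)‖ ≤ t.factorial * (‖W‖ * ‖φ‖ ^ 2) :=
  calc ∑ x, ‖expectationValue W (orbitTransfer x' x φ)‖
      ≤ ∑ x : Fin t → ι, ‖W‖ * ∑ τ : Equiv.Perm (Fin t), ‖slice (x ∘ τ) φ‖ ^ 2 :=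
        Finset.sum_le_sum fun x _ =>
          (norm_expectationValue_le W _).trans_eq (by rw [norm_sq_orbitTransfer])
    _ = t.factorial * (‖W‖ * ‖φ‖ ^ 2) := by
        rw [← Finset.mul_sum, sum_norm_sq_slice_reorder]
        ring

/-- The quadratic form obtained from `⟨φ|W|φ⟩` by averaging `φ` over `P_π F_f` as if `π` and `f`
were uniformly random: the `t` labels are replaced by uniformly random distinct ones, coherently
over their reorderings. -/
def meanForm (W : EuclideanSpace ℂ ((Fin t → ι) × η) →L[ℂ] EuclideanSpace ℂ ((Fin t → ι) × η))
    (φ : EuclideanSpace ℂ ((Fin t → ι) × η)) : ℂ :=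
  (t.factorial : ℂ)⁻¹ * ∑ x' : Fin t ↪ ι, ((Fintype.card ι).descFactorial t : ℂ)⁻¹ *
    ∑ x, expectationValue W (orbitTransfer x' x φ)

variable (W : EuclideanSpace ℂ ((Fin t → ι) × η) →L[ℂ] EuclideanSpace ℂ ((Fin t → ι) × η))
  (φ : EuclideanSpace ℂ ((Fin t → ι) × η))

theorem norm_meanForm_le : ‖meanForm W φ‖ ≤ ‖W‖ * ‖φ‖ ^ 2 := by
  set N : ℝ := ((Fintype.card ι).descFactorial t : ℝ)
  have hN : ∑ _x' : Fin t ↪ ι, N⁻¹ ≤ 1 := by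
    rw [Finset.sum_const, Finset.card_univ, Fintype.card_embedding_eq, Fintype.card_fin,
      nsmul_eq_mul]
    exact mul_inv_le_one
  have ht : (t.factorial : ℝ) ≠ 0 := Nat.cast_ne_zero.mpr t.factorial_ne_zero
  calc ‖meanForm W φ‖
      ≤ (t.factorial : ℝ)⁻¹ * ∑ _x' : Fin t ↪ ι, N⁻¹ * (t.factorial * (‖W‖ * ‖φ‖ ^ 2)) := by
        rw [meanForm, norm_mul, norm_inv, Complex.norm_natCast]
        gcongr
        refine norm_sum_le_of_le _ fun x' _ => ?_
        rw [norm_mul, norm_inv, Complex.norm_natCast]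
        gcongr
        exact (norm_sum_le _ _).trans (sum_norm_expectationValue_orbitTransfer_le W x' φ)
    _ = (∑ _x' : Fin t ↪ ι, N⁻¹) * (‖W‖ * ‖φ‖ ^ 2) := by
        rw [← Finset.sum_mul]
        field_simp
    _ ≤ ‖W‖ * ‖φ‖ ^ 2 := mul_le_of_le_one_left (by positivity) hN

theorem meanForm_tensorAction [DecidableEq η] (U : Matrix.unitaryGroup ι ℂ) :
    meanForm W (tensorAction U φ) = meanForm W φ := by
  have htransfer (x' x : Fin t → ι) : orbitTransfer x' x (tensorAction U φ) =
      ∑ a, tensorPow t (U : Matrix ι ι ℂ) x a • orbitTransfer x' a φ := by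
    simp only [orbitTransfer_apply, Finset.smul_sum]
    rw [Finset.sum_comm]
    refine Finset.sum_congr rfl fun τ _ => ?_
    simp only [slice_tensorAction, map_sum, map_smul,
      ← fun a => tensorPow_comp_perm (U : Matrix ι ι ℂ) x a τ]
    exact ((τ.symm.arrowCongr (Equiv.refl ι)).sum_comp fun a =>
      tensorPow t (U : Matrix ι ι ℂ) (x ∘ τ) a • ketTensor (x' ∘ τ) (slice a φ)).symm
  simp only [meanForm, htransfer,
    sum_expectationValue_unitary_mix W (tensorPow_mem_unitaryGroup U)]

theorem meanForm_eq_distinctPart_add :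
    meanForm W φ = meanForm W (distinctPart φ) + meanForm W (φ - distinctPart φ) := by
  simp only [meanForm, ← mul_add, ← Finset.sum_add_distrib, map_sub, orbitTransfer_distinctPart]
  congr! 6 with x' _ x
  by_cases hx : Function.Injective x <;> simp [hx, expectationValue]

end MeanForm

section PermPhase

variable {ι η : Type*} [Fintype ι] [DecidableEq ι] [Fintype η] {t : ℕ}

theorem permOp_mul_phaseOp_apply (π : Equiv.Perm ι) (f : ι → ZMod 2) (y x : ι) :
    (permOp π * phaseOp f : Matrix.unitaryGroup ι ℂ).1 y x =
      if y = π x then signChar (f x) else 0 := by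
  simp [permOp, phaseOp, signChar_apply]

theorem meanForm_distinctPart
    (W : EuclideanSpace ℂ ((Fin t → ι) × η) →L[ℂ] EuclideanSpace ℂ ((Fin t → ι) × η))
    (φ : EuclideanSpace ℂ ((Fin t → ι) × η)) :
    meanForm W (distinctPart φ) = (t.factorial : ℂ)⁻¹ * ∑ x' : Fin t ↪ ι, ∑ x : Fin t ↪ ι,
      ((Fintype.card ι).descFactorial t : ℂ)⁻¹ * expectationValue W (orbitTransfer x' x φ) := by
  simp only [meanForm, orbitTransfer_distinctPart, ← Finset.mul_sum]
  congr! 4 with x' _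
  rw [← sum_ite_injective fun x => expectationValue W (orbitTransfer x' x φ)]
  refine Finset.sum_congr rfl fun x _ => ?_
  split_ifs <;> simp [expectationValue]

variable [DecidableEq η]

theorem tensorAction_permOp_phaseOp_ketTensor (π : Equiv.Perm ι) (f : ι → ZMod 2) (x : Fin t → ι)
    (v : EuclideanSpace ℂ η) :
    tensorAction (permOp π * phaseOp f) (ketTensor x v) =
      phaseSign f x • ketTensor (π ∘ x) v := by
  ext ⟨y, r⟩
  rw [tensorAction_apply, Finset.sum_eq_single x
    (fun a _ ha => by rw [ketTensor_apply, if_neg ha, mul_zero]) (by simp)]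
  simp only [tensorPow, Matrix.of_apply, permOp_mul_phaseOp_apply, Fintype.prod_ite_zero,
    PiLp.smul_apply, ketTensor_apply, if_true, smul_eq_mul, funext_iff, Function.comp_apply,
    phaseSign]
  split_ifs <;> simp

theorem tensorAction_permOp_phaseOp_distinctPart (π : Equiv.Perm ι) (f : ι → ZMod 2)
    (φ : EuclideanSpace ℂ ((Fin t → ι) × η)) :
    tensorAction (permOp π * phaseOp f) (distinctPart φ) =
      ∑ x : Fin t ↪ ι, phaseSign f x • ketTensor (π ∘ ⇑x) (slice (⇑x) φ) := by
  simp only [distinctPart, map_sum, tensorAction_permOp_phaseOp_ketTensor]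

/-- The expectation of a function of the random unitary `P_π F_f`, for independent `π ∼ D` and
`f ∼ F`. -/
def permPhaseMean (D : PMF (Equiv.Perm ι)) (F : PMF (ι → ZMod 2))
    (h : Matrix.unitaryGroup ι ℂ → ℂ) : ℂ :=
  pmfMean D fun π => pmfMean F fun f => h (permOp π * phaseOp f)

variable {D : PMF (Equiv.Perm ι)} {F : PMF (ι → ZMod 2)} {δ : ℝ}

theorem permPhaseMean_sub (g h : Matrix.unitaryGroup ι ℂ → ℂ) :
    permPhaseMean D F (fun R => g R - h R) = permPhaseMean D F g - permPhaseMean D F h := by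
  simp only [permPhaseMean, pmfMean_sub]

theorem norm_permPhaseMean_le {h : Matrix.unitaryGroup ι ℂ → ℂ} {B : ℝ} (hB : ∀ R, ‖h R‖ ≤ B) :
    ‖permPhaseMean D F h‖ ≤ B :=
  norm_pmfMean_le D fun _ => norm_pmfMean_le F fun _ => hB _

variable (W : EuclideanSpace ℂ ((Fin t → ι) × η) →L[ℂ] EuclideanSpace ℂ ((Fin t → ι) × η))
  (φ : EuclideanSpace ℂ ((Fin t → ι) × η))

theorem pmfMean_expectationValue_distinctPart (hF : IsTWiseIndependent (2 * t) F)
    (ht : 2 * t ≤ Fintype.card ι) (π : Equiv.Perm ι) :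
    pmfMean F (fun f =>
        expectationValue W (tensorAction (permOp π * phaseOp f) (distinctPart φ))) =
      (t.factorial : ℂ)⁻¹ *
        ∑ x : Fin t ↪ ι, expectationValue W (orbitTransfer (x.trans π.toEmbedding) x φ) := by
  have hfact : (t.factorial : ℂ) ≠ 0 := Nat.cast_ne_zero.mpr t.factorial_ne_zero
  set v : (Fin t ↪ ι) → EuclideanSpace ℂ ((Fin t → ι) × η) := fun x =>
    ketTensor (π ∘ ⇑x) (slice (⇑x) φ)
  have hv (x : Fin t ↪ ι) : orbitTransfer (x.trans π.toEmbedding) x φ =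
      ∑ σ : Equiv.Perm (Fin t), v (σ.toEmbedding.trans x) :=
    orbitTransfer_apply _ _ _
  simp only [tensorAction_permOp_phaseOp_distinctPart, hv]
  rw [pmfMean_expectationValue_phaseSign hF ht W v, sum_expectationValue_symmetrized,
    inv_mul_cancel_left₀ hfact]

theorem permPhaseMean_expectationValue_distinctPart (hF : IsTWiseIndependent (2 * t) F)
    (ht : 2 * t ≤ Fintype.card ι) :
    permPhaseMean D F (fun R => expectationValue W (tensorAction R (distinctPart φ))) =
      (t.factorial : ℂ)⁻¹ * ∑ x' : Fin t ↪ ι, ∑ x : Fin t ↪ ι,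
        ((D.toOuterMeasure {π | ∀ i, π (x i) = x' i}).toReal : ℂ) *
          expectationValue W (orbitTransfer x' x φ) := by
  have hevent (x x' : Fin t ↪ ι) : {π : Equiv.Perm ι | x.trans π.toEmbedding = x'} =
      {π | ∀ i, π (x i) = x' i} := Set.ext fun _ => DFunLike.ext_iff
  simp only [permPhaseMean, pmfMean_expectationValue_distinctPart W φ hF ht,
    mul_comm (t.factorial : ℂ)⁻¹, pmfMean_mul_right, pmfMean_sum]
  congr 1
  rw [Finset.sum_comm]
  refine Finset.sum_congr rfl fun x _ => ?_
  rw [pmfMean_comp D (fun π => x.trans π.toEmbedding)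
    fun x' => expectationValue W (orbitTransfer x' x φ)]
  simp only [hevent]

theorem norm_permPhaseMean_distinctPart_sub_meanForm_le (hF : IsTWiseIndependent (2 * t) F)
    (hD : IsApproxTWiseIndependentPerm t δ D) (ht : 2 * t ≤ Fintype.card ι) :
    ‖permPhaseMean D F (fun R => expectationValue W (tensorAction R (distinctPart φ))) -
        meanForm W (distinctPart φ)‖ ≤
      δ * (Fintype.card ι).descFactorial t * (‖W‖ * ‖φ‖ ^ 2) := by
  set e : (Fin t ↪ ι) → (Fin t → ι) → ℂ := fun x' x => expectationValue W (orbitTransfer x' x φ)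
  have he (x' : Fin t ↪ ι) : ∑ x : Fin t ↪ ι, ‖e x' x‖ ≤ t.factorial * (‖W‖ * ‖φ‖ ^ 2) := by
    rw [← sum_ite_injective fun x => ‖e x' x‖]
    refine (Finset.sum_le_sum fun x _ => ?_).trans
      (sum_norm_expectationValue_orbitTransfer_le W x' φ)
    split_ifs
    exacts [le_rfl, norm_nonneg _]
  have hrow (x' : Fin t ↪ ι) : ‖∑ x : Fin t ↪ ι,
      (((D.toOuterMeasure {π | ∀ i, π (x i) = x' i}).toReal : ℂ) -
        ((Fintype.card ι).descFactorial t : ℂ)⁻¹) * e x' x‖ ≤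
      δ * (t.factorial * (‖W‖ * ‖φ‖ ^ 2)) := by
    have hδ : 0 ≤ δ := (abs_nonneg _).trans (hD x' x' x'.injective x'.injective)
    refine (norm_sum_le_of_le _ fun x _ => ?_).trans
      ((Finset.mul_sum _ _ _).symm.trans_le (mul_le_mul_of_nonneg_left (he x') hδ))
    rw [norm_mul]
    refine mul_le_mul_of_nonneg_right ?_ (norm_nonneg _)
    rw [← Complex.ofReal_natCast, ← Complex.ofReal_inv, ← Complex.ofReal_sub, Complex.norm_real,
      Real.norm_eq_abs]
    exact hD x x' x.injective x'.injective
  rw [permPhaseMean_expectationValue_distinctPart W φ hF ht, meanForm_distinctPart, ← mul_sub,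
    ← Finset.sum_sub_distrib]
  simp only [← Finset.sum_sub_distrib, ← sub_mul]
  rw [norm_mul, norm_inv, Complex.norm_natCast, inv_mul_le_iff₀ (by positivity)]
  refine (norm_sum_le_of_le _ fun x' _ => hrow x').trans_eq ?_
  rw [Finset.sum_const, Finset.card_univ, Fintype.card_embedding_eq, Fintype.card_fin,
    nsmul_eq_mul]
  ring

theorem norm_permPhaseMean_sub_meanForm_le (hF : IsTWiseIndependent (2 * t) F)
    (hD : IsApproxTWiseIndependentPerm t δ D) (ht : 2 * t ≤ Fintype.card ι) :
    ‖permPhaseMean D F (fun R => expectationValue W (tensorAction R φ)) - meanForm W φ‖ ≤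
      ‖W‖ * (2 * ‖φ‖ * ‖φ - distinctPart φ‖ + ‖φ - distinctPart φ‖ ^ 2 +
        δ * (Fintype.card ι).descFactorial t * ‖φ‖ ^ 2) := by
  have hdrop : ‖permPhaseMean D F (fun R => expectationValue W (tensorAction R φ)) -
      permPhaseMean D F (fun R => expectationValue W (tensorAction R (distinctPart φ)))‖ ≤
      ‖W‖ * (2 * ‖φ‖ * ‖φ - distinctPart φ‖) := by
    rw [← permPhaseMean_sub]
    refine norm_permPhaseMean_le fun R => (norm_expectationValue_sub_le W _ _).trans ?_
    rw [← map_sub, norm_tensorAction, norm_tensorAction, norm_tensorAction]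
    gcongr
    linarith [norm_distinctPart_le φ]
  have hpseudorandom := norm_permPhaseMean_distinctPart_sub_meanForm_le W φ hF hD ht
  have hrest := norm_meanForm_le W (φ - distinctPart φ)
  rw [meanForm_eq_distinctPart_add W φ, ← sub_sub]
  refine (norm_sub_le _ _).trans ?_
  linarith [norm_sub_le_norm_sub_add_norm_sub
    (permPhaseMean D F fun R => expectationValue W (tensorAction R φ))
    (permPhaseMean D F fun R => expectationValue W (tensorAction R (distinctPart φ)))
    (meanForm W (distinctPart φ))]

end PermPhase

/-! ### Collisions -/

section SchurTest

variable {E α : Type*} [NormedAddCommGroup E] [InnerProductSpace ℂ E] [Fintype α]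

theorem norm_sum_mul_inner_le {k : α → α → ℂ} {B : ℝ} (hrow : ∀ a, ∑ b, ‖k a b‖ ≤ B)
    (hcol : ∀ b, ∑ a, ‖k a b‖ ≤ B) (v : α → E) :
    ‖∑ a, ∑ b, k a b * ⟪v a, v b⟫_ℂ‖ ≤ B * ∑ a, ‖v a‖ ^ 2 := by
  have hterm (a b : α) : ‖k a b * ⟪v a, v b⟫_ℂ‖ ≤
      (‖k a b‖ * ‖v a‖ ^ 2 + ‖k a b‖ * ‖v b‖ ^ 2) / 2 :=
    calc ‖k a b * ⟪v a, v b⟫_ℂ‖ ≤ ‖k a b‖ * (‖v a‖ * ‖v b‖) := by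
          rw [norm_mul]
          gcongr
          exact norm_inner_le_norm _ _
      _ ≤ ‖k a b‖ * ((‖v a‖ ^ 2 + ‖v b‖ ^ 2) / 2) := by
          gcongr
          linarith [two_mul_le_add_sq ‖v a‖ ‖v b‖]
      _ = _ := by ring
  have hleft : ∑ a, ∑ b, ‖k a b‖ * ‖v a‖ ^ 2 ≤ B * ∑ a, ‖v a‖ ^ 2 := by
    simp only [← Finset.sum_mul, Finset.mul_sum]
    gcongr with a
    exact hrow a
  have hright : ∑ a, ∑ b, ‖k a b‖ * ‖v b‖ ^ 2 ≤ B * ∑ a, ‖v a‖ ^ 2 := by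
    rw [Finset.sum_comm]
    simp only [← Finset.sum_mul, Finset.mul_sum]
    gcongr with b
    exact hcol b
  calc ‖∑ a, ∑ b, k a b * ⟪v a, v b⟫_ℂ‖
      ≤ ∑ a, ∑ b, (‖k a b‖ * ‖v a‖ ^ 2 + ‖k a b‖ * ‖v b‖ ^ 2) / 2 :=
        norm_sum_le_of_le _ fun a _ => norm_sum_le_of_le _ fun b _ => hterm a b
    _ = (∑ a, ∑ b, ‖k a b‖ * ‖v a‖ ^ 2 + ∑ a, ∑ b, ‖k a b‖ * ‖v b‖ ^ 2) / 2 := by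
        simp only [← Finset.sum_div, Finset.sum_add_distrib]
    _ ≤ B * ∑ a, ‖v a‖ ^ 2 := by linarith

end SchurTest

section Collision

theorem sum_prod_filter_eq {κ ι R : Type*} [Fintype κ] [DecidableEq κ] [Fintype ι] [DecidableEq ι]
    [CommSemiring R] {i j : κ} (hij : i ≠ j) (h : κ → ι → R) :
    ∑ x : κ → ι with x i = x j, ∏ k, h k (x k) =
      (∑ w, h i w * h j w) * ∏ k ∈ {i, j}ᶜ, ∑ v, h k v := by
  -- Pinning the coordinates `i` and `j` to a common value `w` makes the sum factorize.
  set p : ι → κ → ι → R := fun w k v => if k ∈ ({i, j} : Finset κ) ∧ v ≠ w then 0 else h k v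
  have hpin (x : κ → ι) : (if x i = x j then ∏ k, h k (x k) else 0) = ∑ w, ∏ k, p w k (x k) := by
    have hvanish {w : ι} {k : κ} (hk : k ∈ ({i, j} : Finset κ)) (hw : x k ≠ w) :
        ∏ k, p w k (x k) = 0 :=
      Finset.prod_eq_zero (Finset.mem_univ k) (if_pos ⟨hk, hw⟩)
    rw [Finset.sum_eq_single (x i) (fun w _ hw => hvanish (k := i) (by simp) hw.symm) (by simp)]
    split_ifs with hx
    · refine Finset.prod_congr rfl fun k _ => (if_neg ?_).symm
      rintro ⟨hk, hne⟩
      rcases Finset.mem_insert.mp hk with rfl | hk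
      · exact hne rfl
      · exact hne (Finset.mem_singleton.mp hk ▸ hx.symm)
    · exact (hvanish (k := j) (by simp) (Ne.symm hx)).symm
  have hpair (w : ι) : ∏ k ∈ {i, j}, ∑ v, p w k v = h i w * h j w := by
    rw [Finset.prod_pair hij]
    simp [p]
  have hrest (w : ι) : ∏ k ∈ {i, j}ᶜ, ∑ v, p w k v = ∏ k ∈ {i, j}ᶜ, ∑ v, h k v :=
    Finset.prod_congr rfl fun k hk => Finset.sum_congr rfl fun v _ =>
      if_neg fun hv => Finset.mem_compl.mp hk hv.1
  rw [Finset.sum_filter, Finset.sum_congr rfl fun x _ => hpin x, Finset.sum_comm, Finset.sum_mul]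
  refine Finset.sum_congr rfl fun w _ => ?_
  rw [← Fintype.prod_sum, ← Finset.prod_mul_prod_compl {i, j}, hpair, hrest]

variable {ι η : Type*} [Fintype ι] [DecidableEq ι] {t : ℕ}

/-- The matrix entries of the pullback of the projection onto the tuples with equal labels at
positions `i` and `j` under `U^{⊗ t}`. -/
def collisionKernel (i j : Fin t) (U : Matrix ι ι ℂ) (y z : Fin t → ι) : ℂ :=
  ∑ x : Fin t → ι with x i = x j, star (tensorPow t U x y) * tensorPow t U x z

theorem collisionKernel_eq {i j : Fin t} (hij : i ≠ j) (U : Matrix.unitaryGroup ι ℂ)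
    (y z : Fin t → ι) :
    collisionKernel i j (U : Matrix ι ι ℂ) y z =
      if ∀ k, k ≠ i → k ≠ j → y k = z k then
        ∑ w, star (U.1 w (y i)) * U.1 w (z i) * (star (U.1 w (y j)) * U.1 w (z j)) else 0 := by
  have hcols (a b : ι) : ∑ v, star (U.1 v a) * U.1 v b = if a = b then 1 else 0 := by
    have h := congrFun₂ (Matrix.mem_unitaryGroup_iff'.mp U.2) a b
    simpa only [Matrix.mul_apply, Matrix.star_apply, Matrix.one_apply] using h
  simp only [collisionKernel, tensorPow, Matrix.of_apply, star_prod, ← Finset.prod_mul_distrib]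
  rw [sum_prod_filter_eq hij fun k v => star (U.1 v (y k)) * U.1 v (z k)]
  simp only [hcols, Finset.prod_ite_zero, Finset.prod_const_one, Finset.mem_compl,
    Finset.mem_insert, Finset.mem_singleton, not_or, and_imp, mul_ite, mul_one, mul_zero]

variable [Fintype η]

/-- The weight of `φ` on the tuples with equal labels at positions `i` and `j`. -/
def collisionWeight (i j : Fin t) (φ : EuclideanSpace ℂ ((Fin t → ι) × η)) : ℝ :=
  ∑ x : Fin t → ι with x i = x j, ‖slice x φ‖ ^ 2

theorem norm_sq_sub_distinctPart_le (φ : EuclideanSpace ℂ ((Fin t → ι) × η)) :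
    ‖φ - distinctPart φ‖ ^ 2 ≤
      ∑ p ∈ (Finset.univ : Finset (Fin t)).offDiag, collisionWeight p.1 p.2 φ := by
  simp only [norm_sq_eq_sum_slice, slice_sub_distinctPart, collisionWeight, Finset.sum_filter]
  rw [Finset.sum_comm]
  refine Finset.sum_le_sum fun x _ => ?_
  have hterm (p : Fin t × Fin t) : 0 ≤ if x p.1 = x p.2 then ‖slice x φ‖ ^ 2 else 0 := by
    positivity
  split_ifs with hx
  · simpa using Finset.sum_nonneg fun p _ => hterm p
  · obtain ⟨i, j, hxij, hij⟩ := Function.not_injective_iff.mp hx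
    calc ‖slice x φ‖ ^ 2 = if x i = x j then ‖slice x φ‖ ^ 2 else 0 := (if_pos hxij).symm
      _ ≤ _ := Finset.single_le_sum (a := (i, j)) (fun p _ => hterm p)
          (Finset.mem_offDiag.mpr ⟨Finset.mem_univ i, Finset.mem_univ j, hij⟩)

theorem collisionWeight_tensorAction [DecidableEq η] (i j : Fin t) (U : Matrix.unitaryGroup ι ℂ)
    (φ : EuclideanSpace ℂ ((Fin t → ι) × η)) :
    (collisionWeight i j (tensorAction U φ) : ℂ) =
      ∑ y, ∑ z, collisionKernel i j (U : Matrix ι ι ℂ) y z * ⟪slice y φ, slice z φ⟫_ℂ := by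
  have h := sum_expectationValue_mix (.id ℂ _) {x : Fin t → ι | x i = x j}
    (tensorPow t (U : Matrix ι ι ℂ)) fun a => slice a φ
  simp only [← slice_tensorAction, expectationValue, ContinuousLinearMap.id_apply,
    inner_self_eq_norm_sq_to_K] at h
  simpa [collisionWeight, collisionKernel] using h

end Collision

/-! ### Quadratic phases and the Clifford group -/

section QuadraticPhases

/-- The character `k ↦ i ^ k` of `ZMod 4`. -/
def fourthRootChar : AddChar (ZMod 4) ℂ :=
  AddChar.zmodChar 4 Complex.I_pow_four

theorem fourthRootChar_apply (k : ZMod 4) : fourthRootChar k = Complex.I ^ k.val :=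
  AddChar.zmodChar_apply _ k

theorem fourthRootChar_eq_one_iff {k : ZMod 4} : fourthRootChar k = 1 ↔ k = 0 := by
  rw [fourthRootChar_apply, Complex.isPrimitiveRoot_I.pow_eq_one_iff_dvd,
    Nat.dvd_iff_mod_eq_zero, Nat.mod_eq_of_lt k.val_lt, ZMod.val_eq_zero]

/-- The lift of a bit to `{0, 1} ⊆ ZMod 4`. -/
def liftBit (u : ZMod 2) : ZMod 4 :=
  u.val

theorem fourthRootChar_two_mul_liftBit (u : ZMod 2) :
    fourthRootChar (2 * liftBit u) = signChar u := by
  have hval : ∀ u : ZMod 2, (2 * liftBit u).val = 2 * u.val := by decide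
  rw [fourthRootChar_apply, signChar_apply, hval, pow_mul, Complex.I_sq]

theorem liftBit_add (u v : ZMod 2) :
    liftBit (u + v) = liftBit u + liftBit v + 2 * liftBit (u * v) := by
  revert u v
  decide

theorem two_mul_liftBit_add (u v : ZMod 2) :
    2 * liftBit (u + v) = 2 * liftBit u + 2 * liftBit v := by
  revert u v
  decide

theorem neg_two_mul_liftBit (u : ZMod 2) : -(2 * liftBit u) = 2 * liftBit u := by
  revert u
  decide

theorem liftBit_add_left_cancel {u v w : ZMod 2}
    (h : liftBit u + liftBit v = liftBit u + liftBit w) : v = w := by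
  revert u v w
  decide

theorem eq_swap_of_liftBit {u v y z u' v' y' z' : ZMod 2} (hne : u ≠ y)
    (h : liftBit u + liftBit v = liftBit y + liftBit z)
    (h' : liftBit u' + liftBit v' = liftBit y' + liftBit z')
    (hmul : 2 * liftBit (u * u') + 2 * liftBit (v * v') =
      2 * liftBit (y * y') + 2 * liftBit (z * z')) :
    u' = z' ∧ v' = y' := by
  revert u v y z u' v' y' z'
  decide

/-- The exponents `g` for which `|x⟩ ↦ i^{g(x)} |x⟩` conjugates Pauli operators to Pauli operators:
the finite differences of `g` are affine functions of the form `k + 2 (c ⬝ x)`. -/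
def quadraticPhases (n : ℕ) : AddSubgroup (Bits n → ZMod 4) where
  carrier := {g | ∀ a, ∃ (k : ZMod 4) (c : Bits n), ∀ x,
    g (x + a) = g x + k + 2 * liftBit (c ⬝ᵥ x)}
  zero_mem' _ := ⟨0, 0, fun x => by simp [liftBit]⟩
  add_mem' := by
    intro g g' hg hg' a
    obtain ⟨k, c, h⟩ := hg a
    obtain ⟨k', c', h'⟩ := hg' a
    refine ⟨k + k', c + c', fun x => ?_⟩
    rw [Pi.add_apply, Pi.add_apply, h, h', add_dotProduct, two_mul_liftBit_add]
    ring
  neg_mem' := by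
    intro g hg a
    obtain ⟨k, c, h⟩ := hg a
    refine ⟨-k, c, fun x => ?_⟩
    rw [Pi.neg_apply, Pi.neg_apply, h]
    linear_combination neg_two_mul_liftBit (c ⬝ᵥ x)

instance instFintypeQuadraticPhases (n : ℕ) : Fintype (quadraticPhases n) :=
  Fintype.ofFinite _

variable {n : ℕ}

theorem liftBit_mem_quadraticPhases (i : Fin n) :
    (fun x : Bits n => liftBit (x i)) ∈ quadraticPhases n := fun a =>
  ⟨liftBit (a i), Pi.single i (a i), fun x => by
    beta_reduce
    rw [Pi.add_apply, liftBit_add, single_dotProduct, mul_comm (x i)]⟩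

theorem two_mul_liftBit_mul_mem_quadraticPhases (i j : Fin n) :
    (fun x : Bits n => 2 * liftBit (x i * x j)) ∈ quadraticPhases n := fun a =>
  ⟨2 * liftBit (a i * a j), Pi.single j (a i) + Pi.single i (a j), fun x => by
    beta_reduce
    rw [Pi.add_apply, Pi.add_apply, add_dotProduct, single_dotProduct, single_dotProduct,
      show (x i + a i) * (x j + a j) = x i * x j + a i * a j + (a i * x j + a j * x i) by ring,
      two_mul_liftBit_add, two_mul_liftBit_add (x i * x j)]⟩

theorem eq_or_swap_of_forall_quadraticPhases {y₁ y₂ z₁ z₂ : Bits n}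
    (h : ∀ g ∈ quadraticPhases n, g z₁ + g z₂ = g y₁ + g y₂) :
    (z₁ = y₁ ∧ z₂ = y₂) ∨ (z₁ = y₂ ∧ z₂ = y₁) := by
  have hlin (i : Fin n) := h _ (liftBit_mem_quadraticPhases i)
  have hquad (i j : Fin n) := h _ (two_mul_liftBit_mul_mem_quadraticPhases i j)
  by_cases hzy : z₁ = y₁
  · subst hzy
    exact .inl ⟨rfl, funext fun i => liftBit_add_left_cancel (hlin i)⟩
  · obtain ⟨i, hi⟩ := Function.ne_iff.mp hzy
    have hswap (j : Fin n) := eq_swap_of_liftBit hi (hlin i) (hlin j) (hquad i j)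
    exact .inr ⟨funext fun j => (hswap j).1, funext fun j => (hswap j).2⟩

theorem sum_fourthRootChar_quadraticPhases {y₁ y₂ z₁ z₂ : Bits n}
    (h : ¬((z₁ = y₁ ∧ z₂ = y₂) ∨ (z₁ = y₂ ∧ z₂ = y₁))) :
    ∑ g : quadraticPhases n, fourthRootChar (g.1 z₁ + g.1 z₂ - (g.1 y₁ + g.1 y₂)) = 0 := by
  set e : (x : Bits n) → (Bits n → ZMod 4) →+ ZMod 4 := Pi.evalAddMonoidHom fun _ => ZMod 4
  set ψ : AddChar (quadraticPhases n) ℂ := fourthRootChar.compAddMonoidHom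
    ((e z₁ + e z₂ - (e y₁ + e y₂)).comp (quadraticPhases n).subtype)
  have hψ : ψ ≠ 0 := by
    contrapose! h
    refine eq_or_swap_of_forall_quadraticPhases fun g hg => sub_eq_zero.mp ?_
    exact fourthRootChar_eq_one_iff.mp (AddChar.eq_zero_iff.mp h ⟨g, hg⟩)
  exact AddChar.sum_eq_zero_iff_ne_zero.mpr hψ

end QuadraticPhases

section Clifford

variable {n : ℕ}

theorem mem_cliffordGroup_of_forall_mul_pauliMatrix {U : Matrix.unitaryGroup (Bits n) ℂ}
    (h : ∀ a b : Bits n, ∃ (k : ℕ) (c e : Bits n), (U : Matrix (Bits n) (Bits n) ℂ) *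
      pauliMatrix a b = Complex.I ^ k • (pauliMatrix c e * (U : Matrix (Bits n) (Bits n) ℂ))) :
    U ∈ cliffordGroup n := by
  have hfin : Finite (pauliGroup n : Set (Matrix.unitaryGroup (Bits n) ℂ)) :=
    (finite_pauliGroup n).to_subtype
  refine Subgroup.mem_normalizer_fintype fun P hP => ?_
  obtain ⟨l, a, b, hP⟩ := hP
  obtain ⟨k, c, e, h⟩ := h a b
  refine ⟨l + k, c, e, ?_⟩
  have hU : (U : Matrix (Bits n) (Bits n) ℂ) *
      ((U⁻¹ : Matrix.unitaryGroup (Bits n) ℂ) : Matrix (Bits n) (Bits n) ℂ) = 1 := by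
    rw [← Matrix.UnitaryGroup.mul_val, mul_inv_cancel, Matrix.UnitaryGroup.one_val]
  rw [Matrix.UnitaryGroup.mul_val, Matrix.UnitaryGroup.mul_val, hP, Matrix.mul_smul, h, smul_smul,
    Matrix.smul_mul, Matrix.mul_assoc, hU, Matrix.mul_one, pow_add]

/-- The diagonal unitary `|x⟩ ↦ i^{g(x)} |x⟩`. -/
def diagonalPhase (g : Bits n → ZMod 4) : Matrix.unitaryGroup (Bits n) ℂ :=
  ⟨Matrix.diagonal fun x => fourthRootChar (g x), by
    rw [Matrix.mem_unitaryGroup_iff', Matrix.star_eq_conjTranspose, Matrix.diagonal_conjTranspose,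
      Matrix.diagonal_mul_diagonal, ← Matrix.diagonal_one]
    congr 1
    funext x
    rw [Pi.star_apply, ← starRingEnd_apply, ← AddChar.map_neg_eq_conj, ← AddChar.map_add_eq_mul,
      neg_add_cancel, AddChar.map_zero_eq_one]⟩

theorem pauliMatrix_apply (a b y x : Bits n) :
    pauliMatrix a b y x = if y = x + a then signChar (b ⬝ᵥ x) else 0 := by
  rw [pauliMatrix, Matrix.of_apply, signChar_apply]

theorem diagonalPhase_mem_cliffordGroup {g : Bits n → ZMod 4} (hg : g ∈ quadraticPhases n) :
    diagonalPhase g ∈ cliffordGroup n := by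
  refine mem_cliffordGroup_of_forall_mul_pauliMatrix fun a b => ?_
  obtain ⟨k, c, h⟩ := hg a
  refine ⟨k.val, a, b + c, ?_⟩
  ext y x
  simp only [diagonalPhase, Matrix.diagonal_mul, Matrix.smul_apply, Matrix.mul_diagonal,
    pauliMatrix_apply, smul_eq_mul]
  by_cases hy : y = x + a
  · rw [if_pos hy, if_pos hy, hy, h, ← fourthRootChar_apply, add_dotProduct]
    simp only [AddChar.map_add_eq_mul, fourthRootChar_two_mul_liftBit]
    ring
  · simp only [if_neg hy, mul_zero, zero_mul]

theorem sum_signChar_dotProduct (x : Bits n) :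
    ∑ w : Bits n, signChar (w ⬝ᵥ x) = if x = 0 then 2 ^ n else 0 := by
  have hbit : ∀ u : ZMod 2, ∑ b, signChar (b * u) = if u = 0 then 2 else 0 := by
    intro u
    obtain rfl | rfl : u = 0 ∨ u = 1 := by revert u; decide
    · simp
    · simpa using sum_signChar
  have hprod (w : Bits n) : signChar (w ⬝ᵥ x) = ∏ i, signChar (w i * x i) :=
    map_prod signChar.toMonoidHom (fun i => Multiplicative.ofAdd (w i * x i)) _
  simp only [hprod]
  rw [← Fintype.prod_sum fun i b => signChar (b * x i)]
  simp [hbit, Fintype.prod_ite_zero, funext_iff]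

theorem add_eq_zero_iff_eq_bits {x y : Bits n} : x + y = 0 ↔ x = y := by
  rw [← bits_add_self y, add_left_inj]

theorem ofReal_inv_sqrt_two_pow_mul_self (n : ℕ) :
    (((√((2 : ℝ) ^ n))⁻¹ : ℝ) : ℂ) * ((√((2 : ℝ) ^ n))⁻¹ : ℝ) = ((2 : ℂ) ^ n)⁻¹ := by
  rw [← Complex.ofReal_mul, ← mul_inv, Real.mul_self_sqrt (by positivity)]
  push_cast
  rfl

/-- The `n`-qubit Hadamard gate `H^{⊗ n}`. -/
def hadamardGate (n : ℕ) : Matrix.unitaryGroup (Bits n) ℂ :=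
  ⟨Matrix.of fun y x => ((√((2 : ℝ) ^ n))⁻¹ : ℝ) * signChar (y ⬝ᵥ x), by
    rw [Matrix.mem_unitaryGroup_iff']
    ext x y
    set c : ℝ := (√((2 : ℝ) ^ n))⁻¹
    have hterm (w : Bits n) : star (c * signChar (w ⬝ᵥ x)) * (c * signChar (w ⬝ᵥ y)) =
        ((2 : ℂ) ^ n)⁻¹ * signChar (w ⬝ᵥ (x + y)) := by
      rw [star_mul', star_signChar, Complex.star_def, Complex.conj_ofReal, dotProduct_add,
        AddChar.map_add_eq_mul, ← ofReal_inv_sqrt_two_pow_mul_self]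
      ring
    simp only [Matrix.mul_apply, Matrix.star_apply, Matrix.of_apply, hterm, ← Finset.mul_sum,
      sum_signChar_dotProduct, add_eq_zero_iff_eq_bits, Matrix.one_apply, mul_ite, mul_zero,
      inv_mul_cancel₀ (pow_ne_zero n (two_ne_zero (α := ℂ)))]⟩

theorem hadamardGate_mem_cliffordGroup : hadamardGate n ∈ cliffordGroup n := by
  refine mem_cliffordGroup_of_forall_mul_pauliMatrix fun a b => ⟨2 * (a ⬝ᵥ b).val, b, a, ?_⟩
  ext y x
  have hy (w : Bits n) : y = w + b ↔ w = y + b := by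
    rw [← add_eq_zero_iff_eq_bits, ← add_eq_zero_iff_eq_bits (x := w), ← add_assoc, add_comm w,
      add_right_comm]
  simp only [hadamardGate, Matrix.mul_apply, Matrix.smul_apply, pauliMatrix_apply, Matrix.of_apply,
    smul_eq_mul, hy, mul_ite, ite_mul, mul_zero, zero_mul, Finset.sum_ite_eq', Finset.mem_univ,
    if_true]
  rw [pow_mul, Complex.I_sq, ← signChar_apply]
  simp only [dotProduct_add, add_dotProduct, AddChar.map_add_eq_mul, dotProduct_comm a y]
  linear_combination -(((√((2 : ℝ) ^ n))⁻¹ : ℝ) : ℂ) * signChar (y ⬝ᵥ x) * signChar (y ⬝ᵥ a) *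
    signChar (b ⬝ᵥ x) * signChar_sq (a ⬝ᵥ b)

end Clifford

section CliffordCollision

variable {n t : ℕ}

/-- The unitary that applies the phase `i^{g(x)}` and then the Hadamard gate on every qubit. It is
Clifford when `g` is in `quadraticPhases n`. -/
def hadamardPhase (g : Bits n → ZMod 4) : Matrix.unitaryGroup (Bits n) ℂ :=
  hadamardGate n * diagonalPhase g

theorem hadamardPhase_mem_cliffordGroup {g : Bits n → ZMod 4} (hg : g ∈ quadraticPhases n) :
    hadamardPhase g ∈ cliffordGroup n :=
  mul_mem hadamardGate_mem_cliffordGroup (diagonalPhase_mem_cliffordGroup hg)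

theorem hadamardPhase_apply (g : Bits n → ZMod 4) (w x : Bits n) :
    (hadamardPhase g).1 w x =
      ((√((2 : ℝ) ^ n))⁻¹ : ℝ) * signChar (w ⬝ᵥ x) * fourthRootChar (g x) := by
  simp only [hadamardPhase, hadamardGate, diagonalPhase, Matrix.UnitaryGroup.mul_val,
    Matrix.mul_diagonal, Matrix.of_apply]

theorem star_hadamardPhase_apply_mul (g : Bits n → ZMod 4) (w x y : Bits n) :
    star ((hadamardPhase g).1 w x) * (hadamardPhase g).1 w y =
      ((2 : ℂ) ^ n)⁻¹ * signChar (w ⬝ᵥ (x + y)) * fourthRootChar (g y - g x) := by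
  rw [hadamardPhase_apply, hadamardPhase_apply, star_mul', star_mul', star_signChar]
  simp only [Complex.star_def, Complex.conj_ofReal, ← AddChar.map_neg_eq_conj]
  rw [← ofReal_inv_sqrt_two_pow_mul_self, dotProduct_add, sub_eq_add_neg, AddChar.map_add_eq_mul,
    AddChar.map_add_eq_mul]
  ring

theorem collisionKernel_hadamardPhase {i j : Fin t} (hij : i ≠ j) (g : Bits n → ZMod 4)
    (y z : Fin t → Bits n) :
    collisionKernel i j (hadamardPhase g).1 y z =
      if (∀ k, k ≠ i → k ≠ j → y k = z k) ∧ y i + z i + (y j + z j) = 0 then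
        ((2 : ℂ) ^ n)⁻¹ * fourthRootChar (g (z i) + g (z j) - (g (y i) + g (y j))) else 0 := by
  have hterm (w : Bits n) : star ((hadamardPhase g).1 w (y i)) * (hadamardPhase g).1 w (z i) *
      (star ((hadamardPhase g).1 w (y j)) * (hadamardPhase g).1 w (z j)) =
      ((2 : ℂ) ^ n)⁻¹ * ((2 : ℂ) ^ n)⁻¹ *
        fourthRootChar (g (z i) + g (z j) - (g (y i) + g (y j))) *
        signChar (w ⬝ᵥ (y i + z i + (y j + z j))) := by
    rw [star_hadamardPhase_apply_mul, star_hadamardPhase_apply_mul, dotProduct_add w (y i + z i),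
      add_sub_add_comm, AddChar.map_add_eq_mul signChar, AddChar.map_add_eq_mul fourthRootChar]
    ring
  rw [collisionKernel_eq hij, ite_and]
  refine if_ctx_congr Iff.rfl (fun _ => ?_) fun _ => rfl
  simp only [hterm, ← Finset.mul_sum, sum_signChar_dotProduct]
  split_ifs
  · field_simp
  · rw [mul_zero]

theorem sum_collisionKernel_hadamardPhase_eq_zero {i j : Fin t} (hij : i ≠ j)
    {y z : Fin t → Bits n} (hz : z ≠ y) (hswap : z ≠ y ∘ Equiv.swap i j) :
    ∑ g : quadraticPhases n, collisionKernel i j (hadamardPhase g.1).1 y z = 0 := by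
  simp only [collisionKernel_hadamardPhase hij]
  by_cases h : (∀ k, k ≠ i → k ≠ j → y k = z k) ∧ y i + z i + (y j + z j) = 0
  · simp only [if_pos h, ← Finset.mul_sum]
    rw [sum_fourthRootChar_quadraticPhases, mul_zero]
    rintro (⟨hi, hj⟩ | ⟨hi, hj⟩)
    · refine hz (funext fun k => ?_)
      grind
    · refine hswap (funext fun k => ?_)
      grind
  · simp only [if_neg h, Finset.sum_const_zero]

theorem norm_sum_collisionKernel_hadamardPhase_le {i j : Fin t} (hij : i ≠ j)
    (y z : Fin t → Bits n) :
    ‖∑ g : quadraticPhases n, collisionKernel i j (hadamardPhase g.1).1 y z‖ ≤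
      if z ∈ ({y, y ∘ Equiv.swap i j} : Finset _) then
        Fintype.card (quadraticPhases n) * ((2 : ℝ) ^ n)⁻¹ else 0 := by
  split_ifs with h
  · have hterm (g : quadraticPhases n) :
        ‖collisionKernel i j (hadamardPhase g.1).1 y z‖ ≤ ((2 : ℝ) ^ n)⁻¹ := by
      rw [collisionKernel_hadamardPhase hij]
      split_ifs
      · simp [AddChar.norm_apply]
      · simp
    simpa using norm_sum_le_of_le Finset.univ fun g _ => hterm g
  · simp only [Finset.mem_insert, Finset.mem_singleton, not_or] at h
    rw [sum_collisionKernel_hadamardPhase_eq_zero hij h.1 h.2, norm_zero]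

variable {η : Type*} [Fintype η] [DecidableEq η]

theorem sum_collisionWeight_hadamardPhase_le {i j : Fin t} (hij : i ≠ j)
    (φ : EuclideanSpace ℂ ((Fin t → Bits n) × η)) :
    ∑ g : quadraticPhases n, collisionWeight i j (tensorAction (hadamardPhase g.1) φ) ≤
      Fintype.card (quadraticPhases n) * (2 / 2 ^ n) * ‖φ‖ ^ 2 := by
  set k : (Fin t → Bits n) → (Fin t → Bits n) → ℂ := fun y z =>
    ∑ g : quadraticPhases n, collisionKernel i j (hadamardPhase g.1).1 y z
  have hpair (y : Fin t → Bits n) :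
      ∑ z, (if z ∈ ({y, y ∘ Equiv.swap i j} : Finset _) then
        Fintype.card (quadraticPhases n) * ((2 : ℝ) ^ n)⁻¹ else 0) ≤
      Fintype.card (quadraticPhases n) * (2 / 2 ^ n) := by
    rw [Finset.sum_ite_mem, Finset.univ_inter, Finset.sum_const, nsmul_eq_mul, div_eq_mul_inv]
    have hcard : ((Finset.card {y, y ∘ Equiv.swap i j} : ℕ) : ℝ) ≤ 2 := mod_cast Finset.card_le_two
    nlinarith [show 0 ≤ (Fintype.card (quadraticPhases n) : ℝ) * ((2 : ℝ) ^ n)⁻¹ by positivity]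
  have hmem_symm (y z : Fin t → Bits n) : z ∈ ({y, y ∘ Equiv.swap i j} : Finset _) ↔
      y ∈ ({z, z ∘ Equiv.swap i j} : Finset _) := by
    have hswap (x : Fin t → Bits n) : (x ∘ Equiv.swap i j) ∘ Equiv.swap i j = x := by
      funext k
      simp
    simp only [Finset.mem_insert, Finset.mem_singleton]
    grind
  have hrow (y : Fin t → Bits n) : ∑ z, ‖k y z‖ ≤
      Fintype.card (quadraticPhases n) * (2 / 2 ^ n) :=
    (Finset.sum_le_sum fun z _ => norm_sum_collisionKernel_hadamardPhase_le hij y z).trans (hpair y)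
  have hcol (z : Fin t → Bits n) : ∑ y, ‖k y z‖ ≤
      Fintype.card (quadraticPhases n) * (2 / 2 ^ n) := by
    refine (Finset.sum_le_sum fun y _ =>
      norm_sum_collisionKernel_hadamardPhase_le hij y z).trans ?_
    simpa only [hmem_symm _ z] using hpair z
  have hexpand : ((∑ g : quadraticPhases n,
      collisionWeight i j (tensorAction (hadamardPhase g.1) φ) : ℝ) : ℂ) =
      ∑ y, ∑ z, k y z * ⟪slice y φ, slice z φ⟫_ℂ := by
    simp only [Complex.ofReal_sum, collisionWeight_tensorAction, k, Finset.sum_mul]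
    rw [Finset.sum_comm]
    exact Finset.sum_congr rfl fun y _ => Finset.sum_comm
  calc _ ≤ ‖((∑ g : quadraticPhases n,
        collisionWeight i j (tensorAction (hadamardPhase g.1) φ) : ℝ) : ℂ)‖ := by
        rw [Complex.norm_real]
        exact Real.le_norm_self _
    _ ≤ Fintype.card (quadraticPhases n) * (2 / 2 ^ n) * ‖φ‖ ^ 2 := by
        rw [hexpand, norm_sq_eq_sum_slice]
        exact norm_sum_mul_inner_le hrow hcol _

theorem sum_norm_sq_hadamardPhase_sub_distinctPart_le
    (φ : EuclideanSpace ℂ ((Fin t → Bits n) × η)) :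
    ∑ g : quadraticPhases n, ‖tensorAction (hadamardPhase g.1) φ -
        distinctPart (tensorAction (hadamardPhase g.1) φ)‖ ^ 2 ≤
      Fintype.card (quadraticPhases n) * (2 * t ^ 2 / 2 ^ n) * ‖φ‖ ^ 2 :=
  calc _ ≤ ∑ g : quadraticPhases n, ∑ p ∈ (Finset.univ : Finset (Fin t)).offDiag,
        collisionWeight p.1 p.2 (tensorAction (hadamardPhase g.1) φ) :=
        Finset.sum_le_sum fun g _ => norm_sq_sub_distinctPart_le _
    _ ≤ ∑ p ∈ (Finset.univ : Finset (Fin t)).offDiag,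
        Fintype.card (quadraticPhases n) * (2 / 2 ^ n) * ‖φ‖ ^ 2 := by
        rw [Finset.sum_comm]
        exact Finset.sum_le_sum fun p hp =>
          sum_collisionWeight_hadamardPhase_le (Finset.mem_offDiag.mp hp).2.2 φ
    _ ≤ t ^ 2 * (Fintype.card (quadraticPhases n) * (2 / 2 ^ n) * ‖φ‖ ^ 2) := by
        have hcard : ((Finset.univ : Finset (Fin t)).offDiag.card : ℝ) ≤ t ^ 2 := by
          rw [Finset.offDiag_card, Finset.card_univ, Fintype.card_fin, ← sq]
          exact_mod_cast Nat.sub_le _ _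
        rw [Finset.sum_const, nsmul_eq_mul]
        gcongr
    _ = _ := by ring

end CliffordCollision

/-! ### Ensembles and twirls -/

section Measures

theorem integrable_of_continuous {X E : Type*} [TopologicalSpace X] [CompactSpace X]
    [MeasurableSpace X] [OpensMeasurableSpace X] [NormedAddCommGroup E]
    [SecondCountableTopologyEither X E] (μ : Measure X) [IsFiniteMeasure μ] {h : X → E}
    (hh : Continuous h) : Integrable h μ :=
  hh.integrable_of_hasCompactSupport (HasCompactSupport.of_compactSpace h)

theorem integral_le_sqrt_integral_sq {X : Type*} [TopologicalSpace X] [CompactSpace X]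
    [MeasurableSpace X] [OpensMeasurableSpace X] (μ : Measure X) [IsProbabilityMeasure μ]
    {h : X → ℝ} (hh : Continuous h) : ∫ x, h x ∂μ ≤ √(∫ x, h x ^ 2 ∂μ) := by
  refine Real.le_sqrt_of_sq_le ?_
  exact (even_two.convexOn_pow (𝕜 := ℝ)).map_integral_le (continuous_pow 2).continuousOn
    isClosed_univ (by simp) (integrable_of_continuous μ hh)
    (integrable_of_continuous μ (hh.pow 2))

instance isProbabilityMeasure_haarProb (G : Type*) [Group G] [TopologicalSpace G]
    [IsTopologicalGroup G] [CompactSpace G] [MeasurableSpace G] [BorelSpace G] :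
    IsProbabilityMeasure (haarProb G) :=
  ⟨Measure.haarMeasure_self (K₀ := (⊤ : TopologicalSpace.PositiveCompacts G))⟩

instance isMulLeftInvariant_haarProb (G : Type*) [Group G] [TopologicalSpace G]
    [IsTopologicalGroup G] [CompactSpace G] [MeasurableSpace G] [BorelSpace G] :
    (haarProb G).IsMulLeftInvariant :=
  inferInstanceAs (Measure.haarMeasure _).IsMulLeftInvariant

/-- The law of a Haar random Clifford unitary, as a measure on the unitary group. -/
def cliffordLaw (n : ℕ) : Measure (Matrix.unitaryGroup (Bits n) ℂ) :=
  Measure.map Subtype.val (haarProb (cliffordGroup n))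

instance isProbabilityMeasure_cliffordLaw (n : ℕ) : IsProbabilityMeasure (cliffordLaw n) :=
  Measure.isProbabilityMeasure_map measurable_subtype_coe.aemeasurable

instance smulInvariantMeasure_cliffordLaw (n : ℕ) :
    SMulInvariantMeasure (cliffordGroup n) (Matrix.unitaryGroup (Bits n) ℂ) (cliffordLaw n) :=
  smulInvariantMeasure_map (haarProb (cliffordGroup n)) Subtype.val (fun _ _ => rfl)
    measurable_subtype_coe

end Measures

section PermPhaseEnsemble

variable {ι : Type*} [Fintype ι] [DecidableEq ι] (D : PMF (Equiv.Perm ι)) (F : PMF (ι → ZMod 2))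
  (μ : Measure (Matrix.unitaryGroup ι ℂ))

/-- The law of `P_π F_f U`, for independent `π ∼ D`, `f ∼ F` and `U ∼ μ`. -/
def permPhaseEnsemble : Measure (Matrix.unitaryGroup ι ℂ) :=
  ∑ π, ∑ f, (D π * F f) • Measure.map (fun U => permOp π * phaseOp f * U) μ

theorem pfcEnsemble_eq_permPhaseEnsemble (n : ℕ) (D : PMF (Equiv.Perm (Bits n)))
    (F : PMF (Bits n → ZMod 2)) : pfcEnsemble n D F = permPhaseEnsemble D F (cliffordLaw n) := by
  refine Finset.sum_congr rfl fun π _ => Finset.sum_congr rfl fun f _ => ?_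
  rw [cliffordLaw, Measure.map_map (continuous_const_mul _).measurable measurable_subtype_coe]
  rfl

theorem permPhaseEnsemble_of_isMulLeftInvariant [μ.IsMulLeftInvariant] :
    permPhaseEnsemble D F μ = μ := by
  have hD : ∑ π, D π = 1 := (tsum_fintype _).symm.trans D.tsum_coe
  have hF : ∑ f, F f = 1 := (tsum_fintype _).symm.trans F.tsum_coe
  simp only [permPhaseEnsemble, map_mul_left_eq_self, ← Finset.sum_smul, ← Finset.mul_sum, hF,
    mul_one, hD, one_smul]

variable [IsFiniteMeasure μ]

instance isFiniteMeasure_smul_map_permOp_phaseOp (π : Equiv.Perm ι) (f : ι → ZMod 2) :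
    IsFiniteMeasure ((D π * F f) • Measure.map (fun U => permOp π * phaseOp f * U) μ) :=
  Measure.smul_finite _ (ENNReal.mul_ne_top (D.apply_ne_top π) (F.apply_ne_top f))

instance isFiniteMeasure_permPhaseEnsemble : IsFiniteMeasure (permPhaseEnsemble D F μ) :=
  inferInstanceAs (IsFiniteMeasure (∑ π, ∑ f, (D π * F f) •
    Measure.map (fun U => permOp π * phaseOp f * U) μ))

theorem integral_permPhaseEnsemble {h : Matrix.unitaryGroup ι ℂ → ℂ} (hh : Continuous h) :
    ∫ R, h R ∂permPhaseEnsemble D F μ = ∫ U, permPhaseMean D F (fun R => h (R * U)) ∂μ := by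
  simp only [permPhaseMean, pmfMean]
  rw [permPhaseEnsemble, integral_finsetSum_measure fun π _ => integrable_of_continuous _ hh,
    integral_finsetSum _ fun π _ => integrable_of_continuous μ (by fun_prop)]
  refine Finset.sum_congr rfl fun π _ => ?_
  rw [integral_finsetSum_measure fun f _ => integrable_of_continuous _ hh, integral_const_mul,
    integral_finsetSum _ fun f _ => integrable_of_continuous μ (by fun_prop), Finset.mul_sum]
  refine Finset.sum_congr rfl fun f _ => ?_
  rw [integral_smul_measure, integral_map (continuous_const_mul _).aemeasurable
    hh.aestronglyMeasurable, ENNReal.toReal_mul, integral_const_mul, Complex.real_smul,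
    Complex.ofReal_mul, mul_assoc]

theorem norm_integral_permPhaseEnsemble_le (μ : Measure (Matrix.unitaryGroup ι ℂ))
    [IsProbabilityMeasure μ] {h : Matrix.unitaryGroup ι ℂ → ℂ} {B : ℝ} (hh : Continuous h)
    (hB : ∀ R, ‖h R‖ ≤ B) : ‖∫ R, h R ∂permPhaseEnsemble D F μ‖ ≤ B := by
  rw [integral_permPhaseEnsemble D F μ hh]
  simpa only [probReal_univ, mul_one] using norm_integral_le_of_norm_le_const (μ := μ)
    (Filter.Eventually.of_forall fun U => norm_permPhaseMean_le fun R => hB (R * U))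

end PermPhaseEnsemble

section TwirlTrace

variable {ι η : Type*} [Fintype ι] [DecidableEq ι] [Fintype η] [DecidableEq η] {t : ℕ}
  (ν : Measure (Matrix.unitaryGroup ι ℂ))

theorem extendById_twirl_proj_apply (ψ : EuclideanSpace ℂ ((Fin t → ι) × η))
    (p q : (Fin t → ι) × η) :
    extendById (twirl ν t) (proj ψ) p q = ∫ R, proj (tensorAction R ψ) p q ∂ν := by
  simp only [extendById, twirl, Matrix.of_apply]
  refine integral_congr_ae (Filter.Eventually.of_forall fun R => ?_)
  simp only [proj, Matrix.mul_apply, Matrix.of_apply, Matrix.conjTranspose_apply]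
  rw [← Prod.mk.eta (p := p), ← Prod.mk.eta (p := q), tensorAction_apply, tensorAction_apply]
  simp only [star_sum, star_mul', Finset.sum_mul, Finset.mul_sum]
  exact Finset.sum_congr rfl fun a _ => Finset.sum_congr rfl fun b _ => by ring

theorem trace_mul_proj {κ : Type*} [Fintype κ] [DecidableEq κ] (W : Matrix κ κ ℂ)
    (v : EuclideanSpace ℂ κ) :
    (W * proj v).trace = expectationValue (Matrix.toEuclideanCLM (𝕜 := ℂ) W) v := by
  simp only [expectationValue, PiLp.inner_apply, Matrix.trace, Matrix.diag, Matrix.mul_apply,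
    proj, Matrix.of_apply, Matrix.ofLp_toEuclideanCLM, Matrix.mulVec, dotProduct,
    RCLike.inner_apply, starRingEnd_apply, Finset.sum_mul, mul_assoc]

theorem trace_mul_extendById_twirl [IsFiniteMeasure ν]
    (W : Matrix ((Fin t → ι) × η) ((Fin t → ι) × η) ℂ)
    (ψ : EuclideanSpace ℂ ((Fin t → ι) × η)) :
    (W * extendById (twirl ν t) (proj ψ)).trace =
      ∫ R, expectationValue (Matrix.toEuclideanCLM (𝕜 := ℂ) W) (tensorAction R ψ) ∂ν := by
  have hentry (p q : (Fin t → ι) × η) :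
      Continuous fun R : Matrix.unitaryGroup ι ℂ => proj (tensorAction R ψ) p q := by
    have hcoord (p : (Fin t → ι) × η) :
        Continuous fun R : Matrix.unitaryGroup ι ℂ => tensorAction R ψ p :=
      (EuclideanSpace.proj p).continuous.comp (continuous_tensorAction ψ)
    exact (hcoord p).mul (hcoord q).star
  simp only [← trace_mul_proj, Matrix.trace, Matrix.diag, Matrix.mul_apply,
    extendById_twirl_proj_apply]
  rw [integral_finsetSum _ fun p _ => integrable_of_continuous ν (by fun_prop)]
  refine Finset.sum_congr rfl fun p _ => ?_
  rw [integral_finsetSum _ fun q _ => integrable_of_continuous ν (by fun_prop)]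
  exact Finset.sum_congr rfl fun q _ => (integral_const_mul _ _).symm

theorem isDiamondApproxDesign_of_norm_integral_sub_le [IsFiniteMeasure ν] {ε : ℝ}
    (h : ∀ (W : EuclideanSpace ℂ ((Fin t → ι) × (Fin t → ι)) →L[ℂ]
        EuclideanSpace ℂ ((Fin t → ι) × (Fin t → ι)))
      (ψ : EuclideanSpace ℂ ((Fin t → ι) × (Fin t → ι))), ‖W‖ ≤ 1 → ‖ψ‖ = 1 →
      ‖∫ R, expectationValue W (tensorAction R ψ) ∂ν -
        ∫ R, expectationValue W (tensorAction R ψ) ∂haarProb (Matrix.unitaryGroup ι ℂ)‖ ≤ ε) :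
    IsDiamondApproxDesign ν t ε := by
  refine iSup₂_le fun ψ hψ => ENNReal.ofReal_le_ofReal ?_
  obtain ⟨W, hW, htrace⟩ := exists_norm_le_one_trace_mul_eq_traceNorm
    (extendById (twirl ν t) (proj ψ) -
      extendById (twirl (haarProb (Matrix.unitaryGroup ι ℂ)) t) (proj ψ))
  have hbound := h (Matrix.toEuclideanCLM (𝕜 := ℂ) W) ψ hW hψ
  rw [← trace_mul_extendById_twirl, ← trace_mul_extendById_twirl, ← Matrix.trace_sub,
    ← Matrix.mul_sub, htrace, Complex.norm_real] at hbound
  exact (Real.le_norm_self _).trans hbound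

end TwirlTrace

theorem IsDiamondApproxDesign.mono {ι : Type*} [Fintype ι] [DecidableEq ι]
    {ν : Measure (Matrix.unitaryGroup ι ℂ)} {t : ℕ} {ε ε' : ℝ}
    (h : IsDiamondApproxDesign ν t ε) (hε : ε ≤ ε') : IsDiamondApproxDesign ν t ε' :=
  h.trans (ENNReal.ofReal_le_ofReal hε)

/-! ### The distance to the Haar twirl -/

section MeanCollision

variable {ι η : Type*} [Fintype ι] [DecidableEq ι] [Fintype η] [DecidableEq η] {t : ℕ}

/-- The probability that measuring the `t` registers of the state `(U^{⊗ t} ⊗ 1) φ`, for `U ∼ μ`,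
does not yield `t` distinct labels, when `φ` is a unit vector. -/
def meanCollision (μ : Measure (Matrix.unitaryGroup ι ℂ))
    (φ : EuclideanSpace ℂ ((Fin t → ι) × η)) : ℝ :=
  ∫ U, ‖tensorAction U φ - distinctPart (tensorAction U φ)‖ ^ 2 ∂μ

theorem continuous_norm_tensorAction_sub_distinctPart (φ : EuclideanSpace ℂ ((Fin t → ι) × η)) :
    Continuous fun U : Matrix.unitaryGroup ι ℂ =>
      ‖tensorAction U φ - distinctPart (tensorAction U φ)‖ := by
  have hdistinct : Continuous (distinctPart : EuclideanSpace ℂ ((Fin t → ι) × η) → _) :=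
    continuous_finsetSum _ fun x _ =>
      (ketTensor (⇑x)).continuous.comp (slice (⇑x)).continuous_of_finiteDimensional
  exact ((continuous_tensorAction φ).sub (hdistinct.comp (continuous_tensorAction φ))).norm

theorem continuous_expectationValue_tensorAction
    (W : EuclideanSpace ℂ ((Fin t → ι) × η) →L[ℂ] EuclideanSpace ℂ ((Fin t → ι) × η))
    (φ : EuclideanSpace ℂ ((Fin t → ι) × η)) :
    Continuous fun U : Matrix.unitaryGroup ι ℂ => expectationValue W (tensorAction U φ) :=
  (continuous_tensorAction φ).inner (W.continuous.comp (continuous_tensorAction φ))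

theorem norm_integral_permPhaseEnsemble_sub_meanForm_le_two_mul (D : PMF (Equiv.Perm ι))
    (F : PMF (ι → ZMod 2)) (μ : Measure (Matrix.unitaryGroup ι ℂ)) [IsProbabilityMeasure μ]
    (W : EuclideanSpace ℂ ((Fin t → ι) × η) →L[ℂ] EuclideanSpace ℂ ((Fin t → ι) × η))
    (φ : EuclideanSpace ℂ ((Fin t → ι) × η)) :
    ‖∫ R, expectationValue W (tensorAction R φ) ∂permPhaseEnsemble D F μ - meanForm W φ‖ ≤
      2 * (‖W‖ * ‖φ‖ ^ 2) := by
  have hint := norm_integral_permPhaseEnsemble_le D F μ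
    (continuous_expectationValue_tensorAction W φ) fun R =>
      (norm_expectationValue_le W _).trans_eq (by rw [norm_tensorAction])
  linarith [norm_sub_le (∫ R, expectationValue W (tensorAction R φ) ∂permPhaseEnsemble D F μ)
    (meanForm W φ), norm_meanForm_le W φ]

theorem norm_integral_permPhaseEnsemble_sub_meanForm_le {D : PMF (Equiv.Perm ι)}
    {F : PMF (ι → ZMod 2)} {δ : ℝ} (μ : Measure (Matrix.unitaryGroup ι ℂ))
    [IsProbabilityMeasure μ]
    (W : EuclideanSpace ℂ ((Fin t → ι) × η) →L[ℂ] EuclideanSpace ℂ ((Fin t → ι) × η))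
    (φ : EuclideanSpace ℂ ((Fin t → ι) × η)) (hF : IsTWiseIndependent (2 * t) F)
    (hD : IsApproxTWiseIndependentPerm t δ D) (ht : 2 * t ≤ Fintype.card ι) :
    ‖∫ R, expectationValue W (tensorAction R φ) ∂permPhaseEnsemble D F μ - meanForm W φ‖ ≤
      ‖W‖ * (2 * ‖φ‖ * √(meanCollision μ φ) + meanCollision μ φ +
        δ * (Fintype.card ι).descFactorial t * ‖φ‖ ^ 2) := by
  set c : Matrix.unitaryGroup ι ℂ → ℝ := fun U =>
    ‖tensorAction U φ - distinctPart (tensorAction U φ)‖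
  set e : Matrix.unitaryGroup ι ℂ → ℂ := fun R => expectationValue W (tensorAction R φ)
  have hc : Continuous c := continuous_norm_tensorAction_sub_distinctPart φ
  have he : Continuous e := continuous_expectationValue_tensorAction W φ
  have hint : Integrable c μ := integrable_of_continuous μ hc
  have hint_sq : Integrable (fun U => c U ^ 2) μ := integrable_of_continuous μ (hc.pow 2)
  have hpoint (U : Matrix.unitaryGroup ι ℂ) :
      ‖permPhaseMean D F (fun R => e (R * U)) - meanForm W φ‖ ≤
        ‖W‖ * (2 * ‖φ‖ * c U + c U ^ 2 + δ * (Fintype.card ι).descFactorial t * ‖φ‖ ^ 2) := by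
    simpa only [e, tensorAction_mul, meanForm_tensorAction, norm_tensorAction] using
      norm_permPhaseMean_sub_meanForm_le W (tensorAction U φ) hF hD ht
  have hmean : Continuous fun U => permPhaseMean D F fun R => e (R * U) := by
    simp only [permPhaseMean, pmfMean]
    fun_prop
  calc ‖∫ R, e R ∂permPhaseEnsemble D F μ - meanForm W φ‖
      = ‖∫ U, (permPhaseMean D F (fun R => e (R * U)) - meanForm W φ) ∂μ‖ := by
        rw [integral_permPhaseEnsemble D F μ he,
          integral_sub (integrable_of_continuous μ hmean) (integrable_const _)]
        simp
    _ ≤ ∫ U, ‖W‖ * (2 * ‖φ‖ * c U + c U ^ 2 +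
          δ * (Fintype.card ι).descFactorial t * ‖φ‖ ^ 2) ∂μ :=
        norm_integral_le_of_norm_le (integrable_of_continuous μ (by fun_prop))
          (Filter.Eventually.of_forall hpoint)
    _ = ‖W‖ * (2 * ‖φ‖ * ∫ U, c U ∂μ + meanCollision μ φ +
          δ * (Fintype.card ι).descFactorial t * ‖φ‖ ^ 2) := by
        rw [integral_const_mul, integral_add (by fun_prop) (integrable_const _),
          integral_add (hint.const_mul _) hint_sq, integral_const_mul]
        simp [meanCollision, c]
    _ ≤ _ := by
        gcongr
        exact integral_le_sqrt_integral_sq μ hc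

theorem meanCollision_nonneg (μ : Measure (Matrix.unitaryGroup ι ℂ))
    (φ : EuclideanSpace ℂ ((Fin t → ι) × η)) : 0 ≤ meanCollision μ φ :=
  integral_nonneg fun _ => sq_nonneg _

theorem meanCollision_le {n : ℕ} (μ : Measure (Matrix.unitaryGroup (Bits n) ℂ))
    [IsProbabilityMeasure μ]
    [SMulInvariantMeasure (cliffordGroup n) (Matrix.unitaryGroup (Bits n) ℂ) μ]
    (φ : EuclideanSpace ℂ ((Fin t → Bits n) × η)) :
    meanCollision μ φ ≤ 2 * (t / √(2 ^ n)) ^ 2 * ‖φ‖ ^ 2 := by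
  set c : EuclideanSpace ℂ ((Fin t → Bits n) × η) → ℝ := fun φ => ‖φ - distinctPart φ‖ ^ 2
  have hc (φ : EuclideanSpace ℂ ((Fin t → Bits n) × η)) :
      Continuous fun U : Matrix.unitaryGroup (Bits n) ℂ => c (tensorAction U φ) :=
    (continuous_norm_tensorAction_sub_distinctPart φ).pow 2
  have hinv (g : quadraticPhases n) :
      ∫ U, c (tensorAction (hadamardPhase g.1) (tensorAction U φ)) ∂μ = meanCollision μ φ := by
    simp only [← tensorAction_mul]
    exact integral_smul_eq_self (μ := μ) (fun U => c (tensorAction U φ))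
      (g := (⟨_, hadamardPhase_mem_cliffordGroup g.2⟩ : cliffordGroup n))
  have hint (g : quadraticPhases n) :
      Integrable (fun U => c (tensorAction (hadamardPhase g.1) (tensorAction U φ))) μ := by
    simp only [← tensorAction_mul]
    exact integrable_of_continuous μ ((hc φ).comp (continuous_const_mul _))
  have hcard : (0 : ℝ) < Fintype.card (quadraticPhases n) := Nat.cast_pos.mpr Fintype.card_pos
  refine le_of_mul_le_mul_left ?_ hcard
  calc Fintype.card (quadraticPhases n) * meanCollision μ φ
      = ∫ U, ∑ g : quadraticPhases n,
          c (tensorAction (hadamardPhase g.1) (tensorAction U φ)) ∂μ := by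
        rw [integral_finsetSum _ fun g _ => hint g]
        simp only [hinv, Finset.sum_const, Finset.card_univ, nsmul_eq_mul]
    _ ≤ ∫ _, Fintype.card (quadraticPhases n) * (2 * t ^ 2 / 2 ^ n) * ‖φ‖ ^ 2 ∂μ := by
        refine integral_mono (integrable_finsetSum _ fun g _ => hint g) (integrable_const _)
          fun U => ?_
        simpa only [norm_tensorAction] using
          sum_norm_sq_hadamardPhase_sub_distinctPart_le (tensorAction U φ)
    _ = _ := by
        rw [integral_const, probReal_univ, one_smul, div_pow, Real.sq_sqrt (by positivity)]
        ring

end MeanCollision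

section ErrorBounds

theorem two_mul_le_two_pow_of_sq_lt {n t : ℕ} (h : t ^ 2 < 2 ^ n) : 2 * t ≤ 2 ^ n := by
  obtain rfl | hn := eq_or_ne n 0
  · have ht : t = 0 := by simpa using h
    simp [ht]
  · obtain ht | ht := le_or_gt t 1
    · calc 2 * t ≤ 2 ^ 1 := by omega
        _ ≤ 2 ^ n := Nat.pow_le_pow_right two_pos (Nat.one_le_iff_ne_zero.mpr hn)
    · nlinarith

theorem IsApproxTWiseIndependentPerm.mul_descFactorial_nonneg {α : Type*} [Fintype α] {t : ℕ}
    {δ : ℝ} {D : PMF (Equiv.Perm α)} (hD : IsApproxTWiseIndependentPerm t δ D) :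
    0 ≤ δ * (Fintype.card α).descFactorial t := by
  obtain h | h := isEmpty_or_nonempty (Fin t ↪ α)
  · have hzero : (Fintype.card α).descFactorial t = 0 := by
      simpa only [Fintype.card_embedding_eq, Fintype.card_fin] using
        Fintype.card_eq_zero (α := Fin t ↪ α)
    simp [hzero]
  · obtain ⟨x⟩ := h
    exact mul_nonneg ((abs_nonneg _).trans (hD x x x.injective x.injective)) (Nat.cast_nonneg _)

theorem mul_descFactorial_le_of_le_div_rpow {K₀ δ : ℝ} {n t : ℕ}
    (hδ : δ ≤ K₀ * (t / ((2 : ℝ) ^ n) ^ (4 * (t : ℝ) + 1 / 2))) :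
    δ * (2 ^ n).descFactorial t ≤ |K₀| * (t / √((2 : ℝ) ^ n)) := by
  have hpow : ((2 : ℝ) ^ n) ^ (4 * (t : ℝ) + 1 / 2) = (2 ^ n) ^ (4 * t) * √(2 ^ n) := by
    rw [Real.rpow_add (by positivity), ← Real.sqrt_eq_rpow, ← Real.rpow_natCast (2 ^ n)]
    push_cast
    rfl
  have hN : ((2 ^ n).descFactorial t : ℝ) ≤ (2 ^ n) ^ (4 * t) := by
    exact_mod_cast (Nat.descFactorial_le_pow (2 ^ n) t).trans
      (Nat.pow_le_pow_right (by positivity) (by omega))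
  rw [hpow] at hδ
  calc δ * (2 ^ n).descFactorial t
      ≤ |K₀| * (t / ((2 ^ n) ^ (4 * t) * √(2 ^ n))) * (2 ^ n) ^ (4 * t) := by
        gcongr
        exact hδ.trans (by gcongr; exact le_abs_self K₀)
    _ = |K₀| * (t / √(2 ^ n)) := by field_simp

variable {n t : ℕ} {η : Type*} [Fintype η] [DecidableEq η]

theorem norm_integral_permPhaseEnsemble_sub_meanForm_le_of_clifford
    (μ : Measure (Matrix.unitaryGroup (Bits n) ℂ)) [IsProbabilityMeasure μ]
    [SMulInvariantMeasure (cliffordGroup n) (Matrix.unitaryGroup (Bits n) ℂ) μ]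
    {D : PMF (Equiv.Perm (Bits n))} {F : PMF (Bits n → ZMod 2)} {δ : ℝ}
    (W : EuclideanSpace ℂ ((Fin t → Bits n) × η) →L[ℂ] EuclideanSpace ℂ ((Fin t → Bits n) × η))
    (φ : EuclideanSpace ℂ ((Fin t → Bits n) × η)) (hF : IsTWiseIndependent (2 * t) F)
    (hD : IsApproxTWiseIndependentPerm t δ D) (hW : ‖W‖ ≤ 1) (hφ : ‖φ‖ = 1) :
    ‖∫ R, expectationValue W (tensorAction R φ) ∂permPhaseEnsemble D F μ - meanForm W φ‖ ≤
      5 * (t / √(2 ^ n)) + δ * (2 ^ n).descFactorial t := by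
  set s : ℝ := t / √(2 ^ n)
  have hs_nonneg : 0 ≤ s := by positivity
  have hδ : 0 ≤ δ * (2 ^ n).descFactorial t := by simpa using hD.mul_descFactorial_nonneg
  obtain hs_one | hs_one := le_or_gt 1 s
  · have htrivial := norm_integral_permPhaseEnsemble_sub_meanForm_le_two_mul D F μ W φ
    rw [hφ] at htrivial
    linarith
  · have ht : 2 * t ≤ Fintype.card (Bits n) := by
      have hsq : (t : ℝ) ^ 2 < 2 ^ n :=
        (Real.lt_sqrt (Nat.cast_nonneg t)).mp ((div_lt_one (by positivity)).mp hs_one)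
      simpa using two_mul_le_two_pow_of_sq_lt (by exact_mod_cast hsq)
    have hcoll : meanCollision μ φ ≤ 2 * s ^ 2 := by simpa [hφ] using meanCollision_le μ φ
    have hsqrt : √(meanCollision μ φ) ≤ 3 / 2 * s :=
      Real.sqrt_le_iff.mpr ⟨by positivity, by nlinarith⟩
    have hmain := norm_integral_permPhaseEnsemble_sub_meanForm_le μ W φ hF hD ht
    have hcard : Fintype.card (Bits n) = 2 ^ n := by simp
    rw [hφ, hcard] at hmain
    refine hmain.trans ((mul_le_of_le_one_left ?_ hW).trans ?_)
    · have := meanCollision_nonneg μ φ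
      positivity
    · nlinarith

end ErrorBounds

theorem mainTheorem2_general {n t : ℕ} {F : PMF (Bits n → ZMod 2)} {D : PMF (Equiv.Perm (Bits n))}
    {δ : ℝ} (μ : Measure (Matrix.unitaryGroup (Bits n) ℂ)) [IsProbabilityMeasure μ]
    [SMulInvariantMeasure (cliffordGroup n) (Matrix.unitaryGroup (Bits n) ℂ) μ]
    (hF : IsTWiseIndependent (2 * t) F) (hD : IsApproxTWiseIndependentPerm t δ D) :
    IsDiamondApproxDesign (permPhaseEnsemble D F μ) t
      (10 * (t / √(2 ^ n)) + 2 * (δ * (2 ^ n).descFactorial t)) := by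
  refine isDiamondApproxDesign_of_norm_integral_sub_le _ fun W ψ hW hψ => ?_
  have hensemble := norm_integral_permPhaseEnsemble_sub_meanForm_le_of_clifford μ W ψ hF hD hW hψ
  have hhaar := norm_integral_permPhaseEnsemble_sub_meanForm_le_of_clifford
    (haarProb (Matrix.unitaryGroup (Bits n) ℂ)) W ψ hF hD hW hψ
  rw [permPhaseEnsemble_of_isMulLeftInvariant, norm_sub_rev] at hhaar
  refine (norm_sub_le_norm_sub_add_norm_sub _ (meanForm W ψ) _).trans ?_
  linarith

end

theorem mainTheorem2 (K₀ : ℝ) :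
    ∃ K : ℝ, 0 < K ∧
      ∀ (n t : ℕ) (F : PMF (Bits n → ZMod 2)) (D : PMF (Equiv.Perm (Bits n))) (δ : ℝ),
        δ ≤ K₀ * (t / ((2 : ℝ) ^ n) ^ (4 * (t : ℝ) + 1 / 2)) →
        IsTWiseIndependent (2 * t) F →
        IsApproxTWiseIndependentPerm t δ D →
        IsDiamondApproxDesign (pfcEnsemble n D F) t (K * (t / √((2 : ℝ) ^ n))) := by
  refine ⟨10 + 2 * |K₀|, by positivity, fun n t F D δ hδ hF hD => ?_⟩
  rw [pfcEnsemble_eq_permPhaseEnsemble]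
  exact (mainTheorem2_general (cliffordLaw n) hF hD).mono
    (by linarith [mul_descFactorial_le_of_le_div_rpow hδ])
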